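/- Fix a universe $\mathbf{X}$. A model $\mathbf{X}$-category $\mathbf{M}$ (a locally $\mathbf{X}$-small model category with all $\mathbf{X}$-small limits and colimits) is called \emph{tractable} if its underlying category is locally $\mathbf{X}$-presentable and there exist $\mathbf{X}$-small sets $I$ and $J$ of morphisms such that the trivial fibrations of $\mathbf{M}$ are exactly the morphisms with the right lifting property with respect to $I$, the fibrations are exactly the morphisms with the right lifting property with respect to $J$, and every morphism of $I$ has cofibrant domain. It is called \emph{fully tractable} if $I$ and $J$ can be chosen so that moreover every morphism of $J$ has cofibrant domain. A \emph{Reedy category} is an $\mathbf{X}$-small category $A$ with two subcategories $A^{\leftarrow}$ and $A^{\to}$ containing all objects, and a degree function on the objects of $A$ with values in an ordinal, such that every nonidentity morphism of $A^{\leftarrow}$ strictly lowers the degree, every nonidentity morphism of $A^{\to}$ strictly raises it, and every morphism of $A$ factors uniquely as a morphism of $A^{\leftarrow}$ followed by a morphism of $A^{\to}$. For $X\colon A\to\mathbf{M}$ and $\alpha\in A$, let $L_\alpha X$ be the colimit of $X_\beta$ over the nonidentity morphisms $\beta\to\alpha$ of $A^{\to}$ (a full subcategory of the slice $A^{\to}/\alpha$),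 and let $M^\alpha X$ be the limit of $X_\beta$ over the nonidentity morphisms $\alpha\to\beta$ of $A^{\leftarrow}$ (a full subcategory of the coslice $\alpha/A^{\leftarrow}$). In the \emph{Reedy model structure} on $\mathbf{M}^A$, a morphism $X\to Y$ is a weak equivalence if every $X_\alpha\to Y_\alpha$ is one, a cofibration if every $X_\alpha\sqcup_{L_\alpha X}L_\alpha Y\to Y_\alpha$ is one, and a fibration if every $X_\alpha\to M^\alpha X\times_{M^\alpha Y}Y_\alpha$ is one. \textbf{Lemma.} Let $A$ be an $\mathbf{X}$-small Reedy category and let $\mathbf{M}$ be a tractable model $\mathbf{X}$-category. Then the three classes above form a model structure on $\mathbf{M}^A$, and with it $\mathbf{M}^A$ is tractable. If moreover $\mathbf{M}$ is fully tractable, then so is $\mathbf{M}^A$. -/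

import Mathlib

open CategoryTheory CategoryTheory.Limits HomotopicalAlgebra

universe w v u

section Tractable

variable {D : Type u} [Category.{v} D]

/-- `I` and `J` are `w`-small sets of generating cofibrations and of generating trivial
cofibrations of the model category `D`: the trivial fibrations are exactly the morphisms with the
right lifting property with respect to `I`, and the fibrations are exactly the morphisms with the
right lifting property with respect to `J`. -/
structure IsGeneratingPair [ModelCategory D] (I J : MorphismProperty D) : Prop where
  small_left : MorphismProperty.IsSmall.{w} I
  small_right : MorphismProperty.IsSmall.{w} J
  rlp_left : I.rlp = trivialFibrations D
  rlp_right : J.rlp = fibrations D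

/-- Every morphism of `I` has a cofibrant domain. -/
def HasCofibrantDomains [ModelCategory D] (I : MorphismProperty D) : Prop :=
  ∀ ⦃X Y : D⦄ (f : X ⟶ Y), I f → IsCofibrant X

variable (D)

/-- Combinatorial model categories, with a set of generating cofibrations whose domains are
cofibrant. -/
def IsTractable [ModelCategory D] : Prop :=
  IsLocallyPresentable.{w} D ∧
    ∃ I J : MorphismProperty D, IsGeneratingPair.{w} I J ∧ HasCofibrantDomains I

/-- Combinatorial model categories, with sets of generating cofibrations and of generating trivial
cofibrations, both of whose domains are cofibrant. -/
def IsFullyTractable [ModelCategory D] : Prop :=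
  IsLocallyPresentable.{w} D ∧
    ∃ I J : MorphismProperty D, IsGeneratingPair.{w} I J ∧
      HasCofibrantDomains I ∧ HasCofibrantDomains J

end Tractable

noncomputable section Reedy

variable {A : Type w} [SmallCategory A]

/-- The nonidentity morphisms in a class of morphisms `W`. -/
abbrev nonidentities (W : MorphismProperty A) : MorphismProperty A :=
  W ⊓ (MorphismProperty.identities A)ᶜ

/-- The latching category at `a`: its objects are the nonidentity morphisms `b ⟶ a` in the direct
subcategory `W₂`, its morphisms are the morphisms in `W₂` over `a`. -/
abbrev LatchingCategory (W₂ : MorphismProperty A) [W₂.IsMultiplicative] (a : A) : Type w :=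
  (nonidentities W₂).Over W₂ a

/-- The matching category at `a`: its objects are the nonidentity morphisms `a ⟶ b` in the inverse
subcategory `W₁`, its morphisms are the morphisms in `W₁` under `a`. -/
abbrev MatchingCategory (W₁ : MorphismProperty A) [W₁.IsMultiplicative] (a : A) : Type w :=
  (nonidentities W₁).Under W₁ a

/-- The forgetful functor from the latching category at `a`. -/
def latchingForget (W₂ : MorphismProperty A) [W₂.IsMultiplicative] (a : A) :
    LatchingCategory W₂ a ⥤ A :=
  MorphismProperty.Over.forget (nonidentities W₂) W₂ a ⋙ Over.forget a

/-- The forgetful functor from the matching category at `a`. -/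
def matchingForget (W₁ : MorphismProperty A) [W₁.IsMultiplicative] (a : A) :
    MatchingCategory W₁ a ⥤ A :=
  MorphismProperty.Under.forget (nonidentities W₁) W₁ a ⋙ Under.forget a

variable {C : Type u} [Category.{w} C]

section Latching

variable [HasColimits C] (W₂ : MorphismProperty A) [W₂.IsMultiplicative] (a : A)

/-- The latching object `L_a X`. -/
def latchingObj (X : A ⥤ C) : C := colimit (latchingForget W₂ a ⋙ X)

/-- The morphism `L_a X ⟶ L_a Y` induced by `φ : X ⟶ Y`. -/
def latchingMap {X Y : A ⥤ C} (φ : X ⟶ Y) : latchingObj W₂ a X ⟶ latchingObj W₂ a Y :=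
  colimMap (Functor.whiskerLeft (latchingForget W₂ a) φ)

/-- The colimit inclusion `X b ⟶ L_a X` at a nonidentity direct morphism `f : b ⟶ a`. -/
def latchingIncl (X : A ⥤ C) (f : LatchingCategory W₂ a) : X.obj f.left ⟶ latchingObj W₂ a X :=
  colimit.ι (latchingForget W₂ a ⋙ X) f

/-- The canonical morphism `L_a X ⟶ X a`, given by `X f : X b ⟶ X a` at `f : b ⟶ a`. -/
def latchingι (X : A ⥤ C) : latchingObj W₂ a X ⟶ X.obj a :=
  colimit.desc (latchingForget W₂ a ⋙ X)
    { pt := X.obj a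
      ι :=
        { app := fun f => X.map f.hom
          naturality := fun f g h => by
            have hw : h.left ≫ g.hom = f.hom := MorphismProperty.Over.w h
            change X.map h.left ≫ X.map g.hom = X.map f.hom ≫ 𝟙 _
            rw [← X.map_comp, hw, Category.comp_id] } }

lemma latchingIncl_latchingι (X : A ⥤ C) (f : LatchingCategory W₂ a) :
    latchingIncl W₂ a X f ≫ latchingι W₂ a X = X.map f.hom :=
  colimit.ι_desc _ _

lemma latchingIncl_latchingMap {X Y : A ⥤ C} (φ : X ⟶ Y) (f : LatchingCategory W₂ a) :
    latchingIncl W₂ a X f ≫ latchingMap W₂ a φ = φ.app f.left ≫ latchingIncl W₂ a Y f :=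
  ι_colimMap _ _

/-- Naturality of the canonical morphism from the latching object. -/
lemma latchingι_naturality {X Y : A ⥤ C} (φ : X ⟶ Y) :
    latchingι W₂ a X ≫ φ.app a = latchingMap W₂ a φ ≫ latchingι W₂ a Y := by
  refine colimit.hom_ext fun f => ?_
  change latchingIncl W₂ a X f ≫ _ = latchingIncl W₂ a X f ≫ _
  rw [← Category.assoc, ← Category.assoc, latchingIncl_latchingι, latchingIncl_latchingMap,
    Category.assoc, latchingIncl_latchingι]
  exact φ.naturality f.hom

/-- The relative latching morphism `X a ⨿_{L_a X} L_a Y ⟶ Y a` of `φ : X ⟶ Y`. -/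
def relativeLatchingMap {X Y : A ⥤ C} (φ : X ⟶ Y) :
    pushout (latchingι W₂ a X) (latchingMap W₂ a φ) ⟶ Y.obj a :=
  pushout.desc (φ.app a) (latchingι W₂ a Y) (latchingι_naturality W₂ a φ)

end Latching

section Matching

variable [HasLimits C] (W₁ : MorphismProperty A) [W₁.IsMultiplicative] (a : A)

/-- The matching object `M_a X`. -/
def matchingObj (X : A ⥤ C) : C := limit (matchingForget W₁ a ⋙ X)

/-- The morphism `M_a X ⟶ M_a Y` induced by `φ : X ⟶ Y`. -/
def matchingMap {X Y : A ⥤ C} (φ : X ⟶ Y) : matchingObj W₁ a X ⟶ matchingObj W₁ a Y :=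
  limMap (Functor.whiskerLeft (matchingForget W₁ a) φ)

/-- The limit projection `M_a X ⟶ X b` at a nonidentity inverse morphism `f : a ⟶ b`. -/
def matchingProj (X : A ⥤ C) (f : MatchingCategory W₁ a) : matchingObj W₁ a X ⟶ X.obj f.right :=
  limit.π (matchingForget W₁ a ⋙ X) f

/-- The canonical morphism `X a ⟶ M_a X`, given by `X f : X a ⟶ X b` at `f : a ⟶ b`. -/
def matchingπ (X : A ⥤ C) : X.obj a ⟶ matchingObj W₁ a X :=
  limit.lift (matchingForget W₁ a ⋙ X)
    { pt := X.obj a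
      π :=
        { app := fun f => X.map f.hom
          naturality := fun f g h => by
            have hw : f.hom ≫ h.right = g.hom := MorphismProperty.Under.w h
            change 𝟙 _ ≫ X.map g.hom = X.map f.hom ≫ X.map h.right
            rw [← X.map_comp, hw, Category.id_comp] } }

lemma matchingπ_matchingProj (X : A ⥤ C) (f : MatchingCategory W₁ a) :
    matchingπ W₁ a X ≫ matchingProj W₁ a X f = X.map f.hom :=
  limit.lift_π _ _

lemma matchingMap_matchingProj {X Y : A ⥤ C} (φ : X ⟶ Y) (f : MatchingCategory W₁ a) :
    matchingMap W₁ a φ ≫ matchingProj W₁ a Y f = matchingProj W₁ a X f ≫ φ.app f.right :=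
  limMap_π _ _

/-- Naturality of the canonical morphism to the matching object. -/
lemma matchingπ_naturality {X Y : A ⥤ C} (φ : X ⟶ Y) :
    matchingπ W₁ a X ≫ matchingMap W₁ a φ = φ.app a ≫ matchingπ W₁ a Y := by
  refine limit.hom_ext fun f => ?_
  change _ ≫ matchingProj W₁ a Y f = _ ≫ matchingProj W₁ a Y f
  rw [Category.assoc, Category.assoc, matchingπ_matchingProj, matchingMap_matchingProj,
    ← Category.assoc, matchingπ_matchingProj]
  exact φ.naturality f.hom

/-- The relative matching morphism `X a ⟶ M_a X ×_{M_a Y} Y a` of `φ : X ⟶ Y`. -/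
def relativeMatchingMap {X Y : A ⥤ C} (φ : X ⟶ Y) :
    X.obj a ⟶ pullback (matchingMap W₁ a φ) (matchingπ W₁ a Y) :=
  pullback.lift (matchingπ W₁ a X) (φ.app a) (matchingπ_naturality W₁ a φ)

end Matching

/-- Reedy cofibrations: all relative latching morphisms are cofibrations. -/
def reedyCofibrations [ModelCategory C] [HasColimits C] (W₂ : MorphismProperty A)
    [W₂.IsMultiplicative] : MorphismProperty (A ⥤ C) :=
  fun _ _ φ => ∀ a : A, cofibrations C (relativeLatchingMap W₂ a φ)

/-- Reedy fibrations: all relative matching morphisms are fibrations. -/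
def reedyFibrations [ModelCategory C] [HasLimits C] (W₁ : MorphismProperty A)
    [W₁.IsMultiplicative] : MorphismProperty (A ⥤ C) :=
  fun _ _ φ => ∀ a : A, fibrations C (relativeMatchingMap W₁ a φ)

/-- The model structure `m` on `A ⥤ C` is the Reedy model structure, where `W₁` is the inverse and
`W₂` the direct subcategory of `A`. -/
structure IsReedyModelStructure [ModelCategory C] [HasLimits C] [HasColimits C]
    (W₁ W₂ : MorphismProperty A) [W₁.IsMultiplicative] [W₂.IsMultiplicative]
    (m : ModelCategory (A ⥤ C)) : Prop where
  weakEquivalences_eq : weakEquivalences (A ⥤ C) = (weakEquivalences C).functorCategory A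
  cofibrations_eq : cofibrations (A ⥤ C) = reedyCofibrations W₂
  fibrations_eq : fibrations (A ⥤ C) = reedyFibrations W₁

end Reedy

/-! ### Lifting properties of maps out of pushouts and into pullbacks, and Leibniz constructions. -/

section Lifting

variable {C : Type*} [Category* C]

/-! Lifting problems for diagrams are transposed to lifting problems in `C`. The matching object
functor at `a` has a left adjoint, tensoring with the boundary of the representable functor at `a`.
The Leibniz construction turns `i` in `C` into `boundaryMap W₁ a i`, which lifts against `φ` exactly
when `i` lifts against the relative matching map of `φ` at `a`
(`hasLiftingProperty_boundaryMap_iff`). So the boundary maps built from generators `I` and `J` have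
the expected right lifting classes, and since `A ⥤ C` is locally presentable the small object
argument gives two weak factorization systems.

It remains to identify the left classes. Recursion on the degree shows that maps with the right
relative latching maps do lift (`hasLiftingProperty_of_relative`). Conversely, the condition on
relative latching maps is itself a left lifting property among diagrams
(`hasLiftingProperty_coboundaryMap_iff`), so it need only be tested on the boundary maps. The free
diagram on `F` at `a` has as value at `b` a coproduct of copies of `F` indexed by `a ⟶ b`. The
boundary controls the copies whose index begins with a nonidentity inverse morphism, the latching
object those whose index ends with a nonidentity direct one. By unique factorization only an
identity index escapes both, and there the problem is a lifting problem for `i`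
(`hasLiftingProperty_relativeLatchingMap_boundaryMap`).

Induction on the degree and two-out-of-three match these classes with the pointwise weak
equivalences (`reedyFibrations_inf_weakEquivalences`, `reedyCofibrations_inf_weakEquivalences`).
Domains of boundary maps are cofibrant because they are obtained from a free diagram on a cofibrant
object by a cobase change of a cofibration (`hasLiftingProperty_initial_to_boundaryObj`). -/

lemma hasLiftingProperty_pushout_desc_iff {A B A' Z P Q : C} {f : A ⟶ B} {g : A ⟶ A'}
    [HasPushout f g] (h : B ⟶ Z) (k : A' ⟶ Z) (w : f ≫ h = g ≫ k) (p : P ⟶ Q) :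
    HasLiftingProperty (pushout.desc h k w) p ↔
      ∀ (x : B ⟶ P) (y : A' ⟶ P) (z : Z ⟶ Q), f ≫ x = g ≫ y → h ≫ z = x ≫ p → k ≫ z = y ≫ p →
        ∃ l : Z ⟶ P, h ≫ l = x ∧ k ≫ l = y ∧ l ≫ p = z := by
  constructor
  · intro _ x y z h₁ h₂ h₃
    have sq : CommSq (pushout.desc x y h₁) (pushout.desc h k w) p z :=
      ⟨by apply pushout.hom_ext <;> simp only [pushout.inl_desc_assoc, pushout.inr_desc_assoc, h₂, h₃]⟩
    refine ⟨sq.lift, ?_, ?_, sq.fac_right⟩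
    · simpa only [pushout.inl_desc_assoc, pushout.inl_desc] using pushout.inl f g ≫= sq.fac_left
    · simpa only [pushout.inr_desc_assoc, pushout.inr_desc] using pushout.inr f g ≫= sq.fac_left
  · intro H
    refine ⟨fun {x z} sq => ?_⟩
    obtain ⟨l, h₁, h₂, h₃⟩ := H (pushout.inl f g ≫ x) (pushout.inr f g ≫ x) z
      (pushout.condition_assoc _) (by rw [Category.assoc, sq.w, pushout.inl_desc_assoc])
      (by rw [Category.assoc, sq.w, pushout.inr_desc_assoc])
    exact ⟨⟨l, by apply pushout.hom_ext <;>
      simp only [pushout.inl_desc_assoc, pushout.inr_desc_assoc, h₁, h₂], h₃⟩⟩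

lemma hasLiftingProperty_pullback_lift_iff {A B A' Z P Q : C} {f : B ⟶ A} {g : A' ⟶ A}
    [HasPullback f g] (h : Z ⟶ B) (k : Z ⟶ A') (w : h ≫ f = k ≫ g) (i : P ⟶ Q) :
    HasLiftingProperty i (pullback.lift h k w) ↔
      ∀ (x : Q ⟶ B) (y : Q ⟶ A') (z : P ⟶ Z), x ≫ f = y ≫ g → i ≫ x = z ≫ h → i ≫ y = z ≫ k →
        ∃ l : Q ⟶ Z, l ≫ h = x ∧ l ≫ k = y ∧ i ≫ l = z := by
  constructor
  · intro _ x y z h₁ h₂ h₃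
    have sq : CommSq z i (pullback.lift h k w) (pullback.lift x y h₁) :=
      ⟨by apply pullback.hom_ext <;>
        simp only [Category.assoc, pullback.lift_fst, pullback.lift_snd, h₂, h₃]⟩
    refine ⟨sq.lift, ?_, ?_, sq.fac_left⟩
    · simpa only [Category.assoc, pullback.lift_fst] using sq.fac_right =≫ pullback.fst f g
    · simpa only [Category.assoc, pullback.lift_snd] using sq.fac_right =≫ pullback.snd f g
  · intro H
    refine ⟨fun {z x} sq => ?_⟩
    obtain ⟨l, h₁, h₂, h₃⟩ := H (x ≫ pullback.fst f g) (x ≫ pullback.snd f g) z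
      (by simp only [Category.assoc, pullback.condition])
      (by rw [← Category.assoc, ← sq.w, Category.assoc, pullback.lift_fst])
      (by rw [← Category.assoc, ← sq.w, Category.assoc, pullback.lift_snd])
    exact ⟨⟨l, h₃, by apply pullback.hom_ext <;>
      simp only [Category.assoc, pullback.lift_fst, pullback.lift_snd, h₁, h₂]⟩⟩

end Lifting

section Leibniz

variable {C D : Type*} [Category* C] [Category* D]

/-- The Leibniz construction `G X ⨿_{F X} F Y ⟶ G Y` at a morphism `i : X ⟶ Y`, for a natural
transformation `τ : F ⟶ G`. -/
noncomputable abbrev leibnizPushout [HasPushouts D] {F G : C ⥤ D} (τ : F ⟶ G) {X Y : C}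
    (i : X ⟶ Y) : pushout (τ.app X) (F.map i) ⟶ G.obj Y :=
  pushout.desc (G.map i) (τ.app Y) (τ.naturality i).symm

/-- The Leibniz construction `V X ⟶ U X ×_{U Y} V Y` at a morphism `p : X ⟶ Y`, for a natural
transformation `σ : V ⟶ U`. -/
noncomputable abbrev leibnizPullback [HasPullbacks C] {U V : D ⥤ C} (σ : V ⟶ U) {X Y : D}
    (p : X ⟶ Y) : V.obj X ⟶ pullback (U.map p) (σ.app Y) :=
  pullback.lift (σ.app X) (V.map p) (σ.naturality p).symm

/-- The unit formula for mates combined with naturality of `σ`. This exchange of precomposition and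
postcomposition is what turns pushout lifting problems into pullback ones. -/
lemma homEquiv_conjugateEquiv_symm {F G : C ⥤ D} {U V : D ⥤ C} (adj₁ : F ⊣ U) (adj₂ : G ⊣ V)
    (σ : V ⟶ U) {X : C} {Y : D} (g : G.obj X ⟶ Y) :
    adj₁.homEquiv X Y (((conjugateEquiv adj₂ adj₁).symm σ).app X ≫ g) =
      adj₂.homEquiv X Y g ≫ σ.app Y := by
  have h := unit_conjugateEquiv adj₂ adj₁ ((conjugateEquiv adj₂ adj₁).symm σ) X
  rw [Equiv.apply_symm_apply] at h
  rw [Adjunction.homEquiv_unit, Adjunction.homEquiv_unit, Functor.map_comp, ← Category.assoc, ← h,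
    Category.assoc, Category.assoc, σ.naturality]

/-- The Leibniz constructions of conjugate natural transformations have the same lifting
properties. -/
lemma hasLiftingProperty_leibnizPushout_iff [HasPushouts D] [HasPullbacks C] {F G : C ⥤ D}
    {U V : D ⥤ C} (adj₁ : F ⊣ U) (adj₂ : G ⊣ V) (τ : F ⟶ G) (σ : V ⟶ U)
    (hτ : (conjugateEquiv adj₂ adj₁).symm σ = τ) {A B : C} (i : A ⟶ B) {X Y : D} (p : X ⟶ Y) :
    HasLiftingProperty (leibnizPushout τ i) p ↔ HasLiftingProperty i (leibnizPullback σ p) := by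
  have key {X : C} {Y : D} (g : G.obj X ⟶ Y) :
      adj₁.homEquiv X Y (τ.app X ≫ g) = adj₂.homEquiv X Y g ≫ σ.app Y := by
    rw [← hτ]; exact homEquiv_conjugateEquiv_symm adj₁ adj₂ σ g
  rw [hasLiftingProperty_pushout_desc_iff, hasLiftingProperty_pullback_lift_iff]
  constructor
  · intro H x y z h₁ h₂ h₃
    obtain ⟨x, rfl⟩ := (adj₁.homEquiv _ _).surjective x
    obtain ⟨y, rfl⟩ := (adj₂.homEquiv _ _).surjective y
    obtain ⟨z, rfl⟩ := (adj₂.homEquiv _ _).surjective z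
    simp only [← key, ← Adjunction.homEquiv_naturality_left,
      ← Adjunction.homEquiv_naturality_right, EmbeddingLike.apply_eq_iff_eq] at h₁ h₂ h₃
    obtain ⟨l, e₁, e₂, e₃⟩ := H z x y h₂.symm h₃ h₁.symm
    exact ⟨adj₂.homEquiv _ _ l, by rw [← key, e₂],
      by rw [← Adjunction.homEquiv_naturality_right, e₃],
      by rw [← Adjunction.homEquiv_naturality_left, e₁]⟩
  · intro H x y z h₁ h₂ h₃
    obtain ⟨l, e₁, e₂, e₃⟩ := H (adj₁.homEquiv _ _ y) (adj₂.homEquiv _ _ z) (adj₂.homEquiv _ _ x)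
      (by rw [← key, ← Adjunction.homEquiv_naturality_right, h₃])
      (by rw [← key, ← Adjunction.homEquiv_naturality_left, h₁])
      (by rw [← Adjunction.homEquiv_naturality_left, ← Adjunction.homEquiv_naturality_right, h₂])
    obtain ⟨l, rfl⟩ := (adj₂.homEquiv _ _).surjective l
    simp only [← key, ← Adjunction.homEquiv_naturality_left,
      ← Adjunction.homEquiv_naturality_right, EmbeddingLike.apply_eq_iff_eq] at e₁ e₂ e₃
    exact ⟨l, e₃, e₁, e₂⟩

end Leibniz

/-- Dependent choice along a well-founded degree function: if every partial solution below the
degree of `a` extends to `a`, then there is a global solution. -/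
lemma exists_forall_of_extension {ι α : Type*} [Preorder α] [WellFoundedLT α] (deg : ι → α)
    {T : ι → Type*} (P : ∀ a, T a → (∀ b, deg b < deg a → T b) → Prop)
    (h : ∀ a (t : ∀ b, deg b < deg a → T b),
      (∀ b hb, P b (t b hb) fun c hc => t c (hc.trans hb)) → ∃ x, P a x t) :
    ∃ s : ∀ a, T a, ∀ a, P a (s a) fun b _ => s b := by
  classical
  have wf : WellFounded fun a b : ι => deg a < deg b := InvImage.wf deg wellFounded_lt
  -- An extension exists only if the earlier values already satisfy `P`, which is not known while
  -- the recursion is being defined. The value `none` records failure, and a separate induction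
  -- shows that it never occurs.
  let step (a : ι) (rec : ∀ b, deg b < deg a → Option (T b)) : Option (T a) :=
    if h : ∃ x t, (∀ b hb, rec b hb = some (t b hb)) ∧ P a x t then some h.choose else none
  let s : ∀ a, Option (T a) := wf.fix step
  have hs (a : ι) : ∃ x t, s a = some x ∧ (∀ b (hb : deg b < deg a), s b = some (t b hb)) ∧
      P a x t := by
    induction a using wf.induction with
    | _ a ih =>
      choose x t hx ht hP using ih
      have hex : ∃ y t, (∀ b (hb : deg b < deg a), s b = some (t b hb)) ∧ P a y t := by
        obtain ⟨y, hy⟩ := h a x fun b hb => by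
          -- Both families read off the same values of `s`, so they agree by injectivity of `some`.
          have e : t b hb = fun c hc => x c (hc.trans hb) := by
            funext c hc
            exact Option.some_injective _ ((ht b hb c hc).symm.trans (hx c _))
          simpa only [e] using hP b hb
        exact ⟨y, x, hx, hy⟩
      obtain ⟨t', ht', hP'⟩ := hex.choose_spec
      refine ⟨hex.choose, t', ?_, ht', hP'⟩
      have e : s a = step a fun b _ => s b := wf.fix_eq step a
      rw [e]
      exact dif_pos hex
  choose x t hx ht hP using hs
  refine ⟨x, fun a => ?_⟩
  have e : t a = fun b _ => x b := by
    funext b hb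
    exact Option.some_injective _ ((ht a b hb).symm.trans (hx b))
  simpa only [e] using hP a

/-! ### Local presentability and the small object argument. -/

section LocallyPresentable

variable {D : Type u} [Category.{v} D]

/-- The small object argument needs one cardinal for all domains. A small family of cardinals is
bounded by a regular one, and presentability persists when the cardinal grows. -/
lemma exists_isRegular_forall_isCardinalPresentable [IsLocallyPresentable.{w} D] {ι : Type w}
    (X : ι → D) :
    ∃ (κ : Cardinal.{w}) (_ : Fact κ.IsRegular), ∀ i, IsCardinalPresentable (X i) κ := by
  have h (i : ι) : IsPresentable.{w} (X i) := inferInstance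
  choose κ hκ hX using fun i => (h i).exists_cardinal
  obtain ⟨κ', h₁, h₂⟩ := HasCardinalLT.exists_regular_cardinal_forall.{w} fun i => (κ i).out
  have : Fact κ'.IsRegular := ⟨h₁⟩
  refine ⟨κ', inferInstance, fun i => ?_⟩
  have hle : κ i ≤ κ' := by
    have := (h₂ i).le
    simpa [hasCardinalLT_iff_cardinal_mk_lt] using this
  have : IsCardinalPresentable (X i) (κ i) := hX i
  exact isCardinalPresentable_of_le _ hle

/-- The small object argument applies to small sets of morphisms of a locally presentable
category. -/
lemma hasSmallObjectArgument_of_isLocallyPresentable [IsLocallyPresentable.{w} D] [HasPushouts D]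
    [HasColimitsOfSize.{w, w} D] [LocallySmall.{w} D] (I : MorphismProperty D)
    [MorphismProperty.IsSmall.{w} I] : MorphismProperty.HasSmallObjectArgument.{w} I := by
  obtain ⟨κ, hκ, h⟩ := exists_isRegular_forall_isCardinalPresentable.{w}
    fun f : Shrink.{w} I.toSet => ((equivShrink _).symm f).1.left
  have : Nonempty κ.ord.ToType := by simpa using hκ.out.ne_zero
  have := WellFoundedLT.toOrderBot κ.ord.ToType
  refine ⟨κ, hκ, inferInstance, { preservesColimit := fun {A B X Y} i hi f hf => ?_ }⟩
  have : IsCardinalPresentable A κ := by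
    simpa using h (equivShrink _ ⟨Arrow.mk i, hi⟩)
  have := preservesColimitsOfShape_of_isCardinalPresentable A κ κ.ord.ToType
  infer_instance

/-- Transport along `Aᵒᵖᵒᵖ ≌ A` from `D`-valued presheaves on `Aᵒᵖ`. -/
lemma isLocallyPresentable_functor {A : Type w} [SmallCategory A] [IsLocallyPresentable.{w} D]
    [HasPullbacks D] : IsLocallyPresentable.{w} (A ⥤ D) :=
  ((opOpEquivalence A).congrLeft (E := D)).isLocallyPresentable

end LocallyPresentable

/-! ### Lifting against Reedy fibrations by recursion on the degree. -/

section

variable {A : Type w} [SmallCategory A] {C : Type u} [Category.{w} C]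

section

variable {W₂ : MorphismProperty A} [W₂.IsMultiplicative] [HasColimits C]

lemma hasLiftingProperty_relativeLatchingMap_iff {a : A} {X Y : A ⥤ C} (φ : X ⟶ Y)
    {P Q : C} (p : P ⟶ Q) :
    HasLiftingProperty (relativeLatchingMap W₂ a φ) p ↔
      ∀ (x : X.obj a ⟶ P) (y : latchingObj W₂ a Y ⟶ P) (z : Y.obj a ⟶ Q),
        latchingι W₂ a X ≫ x = latchingMap W₂ a φ ≫ y → φ.app a ≫ z = x ≫ p →
        latchingι W₂ a Y ≫ z = y ≫ p →
        ∃ l : Y.obj a ⟶ P, φ.app a ≫ l = x ∧ latchingι W₂ a Y ≫ l = y ∧ l ≫ p = z :=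
  hasLiftingProperty_pushout_desc_iff _ _ _ _

/-- Morphisms out of a latching object are given by compatible families. -/
lemma exists_latchingObj_desc {a : A} {Y : A ⥤ C} {P : C}
    (t : ∀ g : LatchingCategory W₂ a, Y.obj g.left ⟶ P)
    (ht : ∀ ⦃g g' : LatchingCategory W₂ a⦄ (h : g ⟶ g'), Y.map h.left ≫ t g' = t g) :
    ∃ y : latchingObj W₂ a Y ⟶ P, ∀ g, latchingIncl W₂ a Y g ≫ y = t g :=
  ⟨colimit.desc (latchingForget W₂ a ⋙ Y)
    ⟨P, { app := t, naturality := fun _ _ h => (ht h).trans (Category.comp_id _).symm }⟩,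
    fun g => colimit.ι_desc _ g⟩

lemma latchingObj_hom_ext {a : A} {Y : A ⥤ C} {P : C} {y y' : latchingObj W₂ a Y ⟶ P}
    (h : ∀ g, latchingIncl W₂ a Y g ≫ y = latchingIncl W₂ a Y g ≫ y') : y = y' :=
  colimit.hom_ext h

lemma latchingIncl_w {a : A} (Y : A ⥤ C) ⦃g g' : LatchingCategory W₂ a⦄ (h : g ⟶ g') :
    Y.map h.left ≫ latchingIncl W₂ a Y g' = latchingIncl W₂ a Y g :=
  colimit.w (latchingForget W₂ a ⋙ Y) h

end

section

variable {W₁ : MorphismProperty A} [W₁.IsMultiplicative] [HasLimits C]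

/-- Morphisms into a matching object are given by compatible families. -/
lemma exists_matchingObj_lift {a : A} {Y : A ⥤ C} {P : C}
    (t : ∀ g : MatchingCategory W₁ a, P ⟶ Y.obj g.right)
    (ht : ∀ ⦃g g' : MatchingCategory W₁ a⦄ (h : g ⟶ g'), t g ≫ Y.map h.right = t g') :
    ∃ y : P ⟶ matchingObj W₁ a Y, ∀ g, y ≫ matchingProj W₁ a Y g = t g :=
  ⟨limit.lift (matchingForget W₁ a ⋙ Y)
    ⟨P, { app := t, naturality := fun _ _ h => (Category.id_comp _).trans (ht h).symm }⟩,
    fun g => limit.lift_π _ g⟩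

lemma matchingObj_hom_ext {a : A} {Y : A ⥤ C} {P : C} {y y' : P ⟶ matchingObj W₁ a Y}
    (h : ∀ g, y ≫ matchingProj W₁ a Y g = y' ≫ matchingProj W₁ a Y g) : y = y' :=
  limit.hom_ext h

lemma matchingProj_w {a : A} (Y : A ⥤ C) ⦃g g' : MatchingCategory W₁ a⦄ (h : g ⟶ g') :
    matchingProj W₁ a Y g ≫ Y.map h.right = matchingProj W₁ a Y g' :=
  limit.w (matchingForget W₁ a ⋙ Y) h

lemma hasLiftingProperty_relativeMatchingMap_iff {a : A} {X Y : A ⥤ C} (φ : X ⟶ Y)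
    {P Q : C} (i : P ⟶ Q) :
    HasLiftingProperty i (relativeMatchingMap W₁ a φ) ↔
      ∀ (x : Q ⟶ matchingObj W₁ a X) (y : Q ⟶ Y.obj a) (z : P ⟶ X.obj a),
        x ≫ matchingMap W₁ a φ = y ≫ matchingπ W₁ a Y → i ≫ x = z ≫ matchingπ W₁ a X →
        i ≫ y = z ≫ φ.app a →
        ∃ l : Q ⟶ X.obj a, l ≫ matchingπ W₁ a X = x ∧ l ≫ φ.app a = y ∧ i ≫ l = z :=
  hasLiftingProperty_pullback_lift_iff _ _ _ _

end

end

namespace HomotopicalAlgebra.ReedyStructure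

variable {A : Type w} [SmallCategory A] {W₁ W₂ : MorphismProperty A} [W₁.IsMultiplicative]
  [W₂.IsMultiplicative] {lam : Type v} [LinearOrder lam] [OrderBot lam] [SuccOrder lam]
  [WellFoundedLT lam] (r : ReedyStructure W₁ W₂ lam)

include r in
/-- Naturality of a family of morphisms on the objects in a lower set `S` for the degree can be
checked on the nonidentity morphisms of the inverse and of the direct subcategory. -/
lemma naturality_of_nonidentities {C : Type*} [Category* C] {Y Z : A ⥤ C} {S : A → Prop}
    (hS : ∀ ⦃b c⦄, r.deg b ≤ r.deg c → S c → S b) (t : ∀ b, S b → (Y.obj b ⟶ Z.obj b))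
    (h₁ : ∀ ⦃b c⦄ (g : b ⟶ c) (hb : S b) (hc : S c), nonidentities W₁ g →
      Y.map g ≫ t c hc = t b hb ≫ Z.map g)
    (h₂ : ∀ ⦃b c⦄ (g : b ⟶ c) (hb : S b) (hc : S c), nonidentities W₂ g →
      Y.map g ≫ t c hc = t b hb ≫ Z.map g) ⦃b c : A⦄ (g : b ⟶ c) (hb : S b) (hc : S c) :
    Y.map g ≫ t c hc = t b hb ≫ Z.map g := by
  obtain ⟨d, g₁, g₂, hg₁, hg₂, rfl, -⟩ := r.exists_fac g
  -- Factoring the inverse part first keeps the middle object at degree at most that of `b`, hence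
  -- inside `S`.
  have hd : S d := hS (r.le₁ _ hg₁) hb
  have e₁ : Y.map g₁ ≫ t d hd = t b hb ≫ Z.map g₁ := by
    by_cases h : MorphismProperty.identities A g₁
    · cases h; simp
    · exact h₁ g₁ hb hd ⟨hg₁, h⟩
  have e₂ : Y.map g₂ ≫ t c hc = t d hd ≫ Z.map g₂ := by
    by_cases h : MorphismProperty.identities A g₂
    · cases h; simp
    · exact h₂ g₂ hd hc ⟨hg₂, h⟩
  rw [Y.map_comp, Z.map_comp, Category.assoc, e₂, reassoc_of% e₁]

variable {C : Type u} [Category.{w} C] [HasLimits C] [HasColimits C]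

include r in
/-- A morphism of functors has the left lifting property with respect to another one if its
relative latching morphisms have the left lifting property with respect to the relative matching
morphisms of the other one. -/
lemma hasLiftingProperty_of_relative {X Y X' Y' : A ⥤ C} (f : X ⟶ Y) (p : X' ⟶ Y')
    (h : ∀ a, HasLiftingProperty (relativeLatchingMap W₂ a f) (relativeMatchingMap W₁ a p)) :
    HasLiftingProperty f p := by
  refine ⟨fun {u v} sq => ?_⟩
  have sqa (a : A) : f.app a ≫ v.app a = u.app a ≫ p.app a := (congr_app sq.w a).symm
  -- Besides the two triangles, a component at `a` must be compatible with the earlier ones along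
  -- direct morphisms into `a` and inverse morphisms out of `a`; these suffice for full naturality.
  let P (a : A) (x : Y.obj a ⟶ X'.obj a)
      (t : ∀ b, r.deg b < r.deg a → (Y.obj b ⟶ X'.obj b)) : Prop :=
    f.app a ≫ x = u.app a ∧ x ≫ p.app a = v.app a ∧
      (∀ ⦃b⦄ (g : b ⟶ a) (hg : nonidentities W₂ g),
        Y.map g ≫ x = t b (r.lt₂ g hg.1 hg.2) ≫ X'.map g) ∧
      (∀ ⦃b⦄ (g : a ⟶ b) (hg : nonidentities W₁ g),
        Y.map g ≫ t b (r.lt₁ g hg.1 hg.2) = x ≫ X'.map g)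
  obtain ⟨s, hs⟩ := exists_forall_of_extension r.deg P fun a t ht => by
    have nat ⦃b c : A⦄ (g : b ⟶ c) (hb : r.deg b < r.deg a) (hc : r.deg c < r.deg a) :
        Y.map g ≫ t c hc = t b hb ≫ X'.map g :=
      r.naturality_of_nonidentities (fun b c h hc => h.trans_lt hc) t
        (fun b c g hb hc hg => (ht b hb).2.2.2 g hg)
        (fun b c g hb hc hg => (ht c hc).2.2.1 g hg) g hb hc
    have hl (g : LatchingCategory W₂ a) : r.deg g.left < r.deg a := r.lt₂ g.hom g.prop.1 g.prop.2
    have hm (g : MatchingCategory W₁ a) : r.deg g.right < r.deg a := r.lt₁ g.hom g.prop.1 g.prop.2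
    -- The components already built prescribe the new one on `L_a Y` through `y` and after
    -- projection to `M_a X'` through `x`.
    obtain ⟨y, hy⟩ := exists_latchingObj_desc (Y := Y)
      (fun g : LatchingCategory W₂ a => t g.left (hl g) ≫ X'.map g.hom) fun g g' k => by
        have hw : k.left ≫ g'.hom = g.hom := MorphismProperty.Over.w k
        have e := nat k.left (hl g) (hl g')
        rw [reassoc_of% e, ← X'.map_comp, hw]
    obtain ⟨x, hx⟩ := exists_matchingObj_lift (Y := X')
      (fun g : MatchingCategory W₁ a => Y.map g.hom ≫ t g.right (hm g)) fun g g' k => by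
        have hw : g.hom ≫ k.right = g'.hom := MorphismProperty.Under.w k
        rw [Category.assoc, ← nat k.right (hm g) (hm g'), ← Y.map_comp_assoc, hw]
    have hfl ⦃b : A⦄ (hb : r.deg b < r.deg a) : f.app b ≫ t b hb = u.app b := (ht b hb).1
    have hfr ⦃b : A⦄ (hb : r.deg b < r.deg a) : t b hb ≫ p.app b = v.app b := (ht b hb).2.1
    have h₁ : x ≫ matchingMap W₁ a p = v.app a ≫ matchingπ W₁ a Y' := by
      refine matchingObj_hom_ext fun g => ?_
      rw [Category.assoc, Category.assoc, matchingMap_matchingProj, reassoc_of% hx, hfr,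
        matchingπ_matchingProj]
      exact v.naturality g.hom
    have h₂ : latchingι W₂ a X ≫ u.app a = latchingMap W₂ a f ≫ y := by
      refine latchingObj_hom_ext fun g => ?_
      rw [← Category.assoc, latchingIncl_latchingι, ← Category.assoc, latchingIncl_latchingMap,
        Category.assoc, hy, reassoc_of% (hfl (hl g))]
      exact u.naturality g.hom
    -- The two prescriptions agree by naturality along composites `b ⟶ a ⟶ c`. Such a composite
    -- passes through `a`, but both of its ends have smaller degree, so `nat` covers it by
    -- refactoring it.
    have hyx : latchingι W₂ a Y ≫ x = y ≫ matchingπ W₁ a X' := by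
      refine latchingObj_hom_ext fun g => matchingObj_hom_ext fun g' => ?_
      rw [Category.assoc, Category.assoc, Category.assoc, Category.assoc, hx,
        matchingπ_matchingProj, reassoc_of% hy, ← Category.assoc, latchingIncl_latchingι,
        ← X'.map_comp]
      have e : Y.map (g.hom ≫ g'.hom) ≫ t g'.right (hm g') =
        t g.left (hl g) ≫ X'.map (g.hom ≫ g'.hom) := nat (g.hom ≫ g'.hom) (hl g) (hm g')
      rw [Y.map_comp, Category.assoc] at e
      exact e
    have hxf : f.app a ≫ x = u.app a ≫ matchingπ W₁ a X' := by
      refine matchingObj_hom_ext fun g => ?_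
      rw [Category.assoc, Category.assoc, hx, matchingπ_matchingProj]
      have e : X.map g.hom ≫ f.app g.right = f.app a ≫ Y.map g.hom := f.naturality g.hom
      have e' : X.map g.hom ≫ u.app g.right = u.app a ≫ X'.map g.hom := u.naturality g.hom
      rw [← hfl (hm g), reassoc_of% e] at e'
      exact e'
    have hyp : latchingι W₂ a Y ≫ v.app a = y ≫ p.app a := by
      refine latchingObj_hom_ext fun g => ?_
      have e : X'.map g.hom ≫ p.app a = p.app g.left ≫ Y'.map g.hom := p.naturality g.hom
      have e' : Y.map g.hom ≫ v.app a = v.app g.left ≫ Y'.map g.hom := v.naturality g.hom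
      rw [← hfr (hl g), Category.assoc, ← e] at e'
      rw [← Category.assoc, latchingIncl_latchingι, reassoc_of% hy]
      exact e'
    obtain ⟨l, hl₁, hl₂, hl₃⟩ := (hasLiftingProperty_relativeLatchingMap_iff f _).1 (h a)
      (u.app a) y (pullback.lift x (v.app a) h₁) h₂
      (by
        apply pullback.hom_ext
        · simp only [relativeMatchingMap, Category.assoc, pullback.lift_fst, hxf]
        · simp only [relativeMatchingMap, Category.assoc, pullback.lift_snd, sqa])
      (by
        apply pullback.hom_ext
        · simp only [relativeMatchingMap, Category.assoc, pullback.lift_fst, hyx]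
        · simp only [relativeMatchingMap, Category.assoc, pullback.lift_snd, hyp])
    have hl₄ : l ≫ matchingπ W₁ a X' = x := by
      simpa only [relativeMatchingMap, Category.assoc, pullback.lift_fst] using
        hl₃ =≫ pullback.fst _ _
    have hl₅ : l ≫ p.app a = v.app a := by
      simpa only [relativeMatchingMap, Category.assoc, pullback.lift_snd] using
        hl₃ =≫ pullback.snd _ _
    refine ⟨l, hl₁, hl₅, fun b g hg => ?_, fun b g hg => ?_⟩
    · let g' : LatchingCategory W₂ a := MorphismProperty.Over.mk _ g hg
      have := hy g'
      rw [← hl₂, ← Category.assoc, latchingIncl_latchingι] at this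
      exact this
    · let g' : MatchingCategory W₁ a := MorphismProperty.Under.mk _ g hg
      have := hx g'
      rw [← hl₄, Category.assoc, matchingπ_matchingProj] at this
      exact this.symm
  have nat := r.naturality_of_nonidentities (S := fun _ => True) (fun _ _ _ _ => trivial)
    (fun b _ => s b) (fun b c g _ _ hg => (hs b).2.2.2 g hg)
    (fun b c g _ _ hg => (hs c).2.2.1 g hg)
  exact ⟨⟨{ app := s, naturality := fun b c g => nat g trivial trivial },
    by ext a; exact (hs a).1, by ext a; exact (hs a).2.1⟩⟩

end HomotopicalAlgebra.ReedyStructure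

/-! ### Latching and matching objects in terms of nonidentity morphisms. -/

section

variable {A : Type w} [SmallCategory A] {C : Type u} [Category.{w} C]

section

variable {W₁ : MorphismProperty A} [W₁.IsMultiplicative] [HasLimits C] {a : A}

/-- The projection `M_a X ⟶ X b` at a nonidentity inverse morphism `a ⟶ b`. -/
noncomputable def matchingProjAt (X : A ⥤ C) {b : A} (g : a ⟶ b) (hg : nonidentities W₁ g) :
    matchingObj W₁ a X ⟶ X.obj b :=
  matchingProj W₁ a X (MorphismProperty.Under.mk _ g hg)

lemma matchingProjAt_map (X : A ⥤ C) {b c : A} (g : a ⟶ b) (hg : nonidentities W₁ g) (k : b ⟶ c)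
    (hk : W₁ k) (hgk : nonidentities W₁ (g ≫ k)) :
    matchingProjAt X g hg ≫ X.map k = matchingProjAt X (g ≫ k) hgk :=
  matchingProj_w X (MorphismProperty.Under.homMk k rfl hk :
    MorphismProperty.Under.mk _ g hg ⟶ MorphismProperty.Under.mk _ (g ≫ k) hgk)

lemma matchingπ_matchingProjAt (X : A ⥤ C) {b : A} (g : a ⟶ b) (hg : nonidentities W₁ g) :
    matchingπ W₁ a X ≫ matchingProjAt X g hg = X.map g :=
  matchingπ_matchingProj W₁ a X (MorphismProperty.Under.mk _ g hg)

lemma matchingMap_matchingProjAt {X Y : A ⥤ C} (φ : X ⟶ Y) {b : A} (g : a ⟶ b)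
    (hg : nonidentities W₁ g) :
    matchingMap W₁ a φ ≫ matchingProjAt Y g hg = matchingProjAt X g hg ≫ φ.app b :=
  matchingMap_matchingProj W₁ a φ (MorphismProperty.Under.mk _ g hg)

lemma matchingObj_hom_ext_at {X : A ⥤ C} {P : C} {y y' : P ⟶ matchingObj W₁ a X}
    (h : ∀ ⦃b : A⦄ (g : a ⟶ b) (hg : nonidentities W₁ g),
      y ≫ matchingProjAt X g hg = y' ≫ matchingProjAt X g hg) : y = y' :=
  matchingObj_hom_ext fun g => h g.hom g.prop

/-- Morphisms into a matching object are given by families which are compatible with the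
nonidentity morphisms. -/
lemma exists_matchingObj_lift_at {Y : A ⥤ C} {P : C}
    (t : ∀ ⦃b : A⦄ (g : a ⟶ b), nonidentities W₁ g → (P ⟶ Y.obj b))
    (ht : ∀ ⦃b c : A⦄ (g : a ⟶ b) (hg : nonidentities W₁ g) (k : b ⟶ c)
      (_ : nonidentities W₁ k) (hgk : nonidentities W₁ (g ≫ k)), t g hg ≫ Y.map k = t (g ≫ k) hgk) :
    ∃ y : P ⟶ matchingObj W₁ a Y,
      ∀ ⦃b : A⦄ (g : a ⟶ b) (hg : nonidentities W₁ g), y ≫ matchingProjAt Y g hg = t g hg := by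
  have key ⦃b c : A⦄ (f : a ⟶ b) (f' : a ⟶ c) (k : b ⟶ c) (hk : W₁ k) (e : f ≫ k = f')
      (hf : nonidentities W₁ f) (hf' : nonidentities W₁ f') : t f hf ≫ Y.map k = t f' hf' := by
    subst e
    by_cases h : MorphismProperty.identities A k
    · cases h; simp
    · exact ht f hf k ⟨hk, h⟩ hf'
  obtain ⟨y, hy⟩ := exists_matchingObj_lift (Y := Y) (W₁ := W₁) (a := a)
    (fun g => t g.hom g.prop) fun g g' m =>
      key g.hom g'.hom m.right m.prop_hom_right (MorphismProperty.Under.w m) g.prop g'.prop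
  exact ⟨y, fun b g hg => hy (MorphismProperty.Under.mk _ g hg)⟩

end

section

variable {W₂ : MorphismProperty A} [W₂.IsMultiplicative] [HasColimits C] {a : A}

/-- The inclusion `X b ⟶ L_a X` at a nonidentity direct morphism `b ⟶ a`. -/
noncomputable def latchingInclAt (X : A ⥤ C) {b : A} (g : b ⟶ a) (hg : nonidentities W₂ g) :
    X.obj b ⟶ latchingObj W₂ a X :=
  latchingIncl W₂ a X (MorphismProperty.Over.mk _ g hg)

lemma map_latchingInclAt (X : A ⥤ C) {b c : A} (g : b ⟶ a) (hg : nonidentities W₂ g) (k : c ⟶ b)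
    (hk : W₂ k) (hkg : nonidentities W₂ (k ≫ g)) :
    X.map k ≫ latchingInclAt X g hg = latchingInclAt X (k ≫ g) hkg :=
  latchingIncl_w X (MorphismProperty.Over.homMk k rfl hk :
    MorphismProperty.Over.mk _ (k ≫ g) hkg ⟶ MorphismProperty.Over.mk _ g hg)

lemma map_latchingInclAt_assoc (X : A ⥤ C) {b c : A} (g : b ⟶ a) (hg : nonidentities W₂ g)
    (k : c ⟶ b) (hk : W₂ k) (hkg : nonidentities W₂ (k ≫ g)) {Z : C}
    (h : latchingObj W₂ a X ⟶ Z) :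
    X.map k ≫ latchingInclAt X g hg ≫ h = latchingInclAt X (k ≫ g) hkg ≫ h := by
  rw [← Category.assoc, map_latchingInclAt X g hg k hk hkg]

lemma latchingInclAt_latchingι (X : A ⥤ C) {b : A} (g : b ⟶ a) (hg : nonidentities W₂ g) :
    latchingInclAt X g hg ≫ latchingι W₂ a X = X.map g :=
  latchingIncl_latchingι W₂ a X (MorphismProperty.Over.mk _ g hg)

lemma latchingInclAt_latchingι_assoc (X : A ⥤ C) {b : A} (g : b ⟶ a) (hg : nonidentities W₂ g)
    {Z : C} (h : X.obj a ⟶ Z) :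
    latchingInclAt X g hg ≫ latchingι W₂ a X ≫ h = X.map g ≫ h := by
  rw [← Category.assoc, latchingInclAt_latchingι]

lemma latchingInclAt_latchingMap {X Y : A ⥤ C} (φ : X ⟶ Y) {b : A} (g : b ⟶ a)
    (hg : nonidentities W₂ g) :
    latchingInclAt X g hg ≫ latchingMap W₂ a φ = φ.app b ≫ latchingInclAt Y g hg :=
  latchingIncl_latchingMap W₂ a φ (MorphismProperty.Over.mk _ g hg)

lemma latchingInclAt_latchingMap_assoc {X Y : A ⥤ C} (φ : X ⟶ Y) {b : A} (g : b ⟶ a)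
    (hg : nonidentities W₂ g) {Z : C} (h : latchingObj W₂ a Y ⟶ Z) :
    latchingInclAt X g hg ≫ latchingMap W₂ a φ ≫ h = φ.app b ≫ latchingInclAt Y g hg ≫ h := by
  rw [← Category.assoc, latchingInclAt_latchingMap, Category.assoc]

lemma latchingObj_hom_ext_at {X : A ⥤ C} {P : C} {y y' : latchingObj W₂ a X ⟶ P}
    (h : ∀ ⦃b : A⦄ (g : b ⟶ a) (hg : nonidentities W₂ g),
      latchingInclAt X g hg ≫ y = latchingInclAt X g hg ≫ y') : y = y' :=
  latchingObj_hom_ext fun g => h g.hom g.prop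

/-- Morphisms out of a latching object are given by families which are compatible with the
nonidentity morphisms. -/
lemma exists_latchingObj_desc_at {Y : A ⥤ C} {P : C}
    (t : ∀ ⦃b : A⦄ (g : b ⟶ a), nonidentities W₂ g → (Y.obj b ⟶ P))
    (ht : ∀ ⦃b c : A⦄ (g : b ⟶ a) (hg : nonidentities W₂ g) (k : c ⟶ b)
      (_ : nonidentities W₂ k) (hkg : nonidentities W₂ (k ≫ g)), Y.map k ≫ t g hg = t (k ≫ g) hkg) :
    ∃ y : latchingObj W₂ a Y ⟶ P,
      ∀ ⦃b : A⦄ (g : b ⟶ a) (hg : nonidentities W₂ g), latchingInclAt Y g hg ≫ y = t g hg := by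
  have key ⦃b c : A⦄ (f : b ⟶ a) (f' : c ⟶ a) (k : c ⟶ b) (hk : W₂ k) (e : k ≫ f = f')
      (hf : nonidentities W₂ f) (hf' : nonidentities W₂ f') : Y.map k ≫ t f hf = t f' hf' := by
    subst e
    by_cases h : MorphismProperty.identities A k
    · cases h; simp
    · exact ht f hf k ⟨hk, h⟩ hf'
  obtain ⟨y, hy⟩ := exists_latchingObj_desc (Y := Y) (W₂ := W₂) (a := a)
    (fun g => t g.hom g.prop) fun g g' m =>
      key g'.hom g.hom m.left m.prop_hom_left (MorphismProperty.Over.w m) g'.prop g.prop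
  exact ⟨y, fun b g hg => hy (MorphismProperty.Over.mk _ g hg)⟩

end

end

/-! ### Lifting properties of the maps induced on matching and latching objects. -/

namespace HomotopicalAlgebra.ReedyStructure

variable {A : Type w} [SmallCategory A] {W₁ W₂ : MorphismProperty A} [W₁.IsMultiplicative]
  [W₂.IsMultiplicative] {lam : Type v} [LinearOrder lam] [OrderBot lam] [SuccOrder lam]
  [WellFoundedLT lam] (r : ReedyStructure W₁ W₂ lam) {C : Type u} [Category.{w} C]

-- An identity composite would return to the initial degree, but the first factor strictly lowers
-- the degree and the second cannot raise it.
include r in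
lemma nonidentities_comp₁ {a b c : A} {f : a ⟶ b} {g : b ⟶ c} (hf : nonidentities W₁ f)
    (hg : W₁ g) : nonidentities W₁ (f ≫ g) := by
  refine ⟨W₁.comp_mem _ _ hf.1 hg, fun h => ?_⟩
  have h₁ := r.lt₁ f hf.1 hf.2
  have h₂ := r.le₁ g hg
  generalize f ≫ g = k at h
  cases h
  exact (h₂.trans_lt h₁).false

include r in
lemma nonidentities_comp₂ {a b c : A} {f : a ⟶ b} {g : b ⟶ c} (hf : W₂ f)
    (hg : nonidentities W₂ g) : nonidentities W₂ (f ≫ g) := by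
  refine ⟨W₂.comp_mem _ _ hf hg.1, fun h => ?_⟩
  have h₁ := r.le₂ f hf
  have h₂ := r.lt₂ g hg.1 hg.2
  generalize f ≫ g = k at h
  cases h
  exact (h₁.trans_lt h₂).false

/-- The morphism `M_a φ` has the right lifting property with respect to `i` if the relative
matching morphisms of `φ` at objects of smaller degree do. -/
lemma hasLiftingProperty_matchingMap [HasLimits C] {X Y : A ⥤ C} (φ : X ⟶ Y) {E F : C} (i : E ⟶ F)
    (a : A) (h : ∀ b, r.deg b < r.deg a → HasLiftingProperty i (relativeMatchingMap W₁ b φ)) :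
    HasLiftingProperty i (matchingMap W₁ a φ) := by
  refine ⟨fun {e y} sq => ?_⟩
  -- The lift into `M_a X` is built one projection at a time, by recursion on the degree of the
  -- target `b` of `f`. Composites of `f` with nonidentity inverse morphisms have targets of smaller
  -- degree, and their projections form the prescribed map to `M_b X`. What is left is a lifting
  -- problem against the relative matching map at `b`.
  let ι : Type w := Σ b, { f : a ⟶ b // nonidentities W₁ f }
  let P (k : ι) (x : F ⟶ X.obj k.1)
      (t : ∀ k' : ι, r.deg k'.1 < r.deg k.1 → (F ⟶ X.obj k'.1)) : Prop :=
    i ≫ x = e ≫ matchingProjAt X k.2.1 k.2.2 ∧ x ≫ φ.app k.1 = y ≫ matchingProjAt Y k.2.1 k.2.2 ∧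
      ∀ ⦃b : A⦄ (g : k.1 ⟶ b) (hg : nonidentities W₁ g),
        x ≫ X.map g = t ⟨b, k.2.1 ≫ g, r.nonidentities_comp₁ k.2.2 hg.1⟩ (r.lt₁ _ hg.1 hg.2)
  obtain ⟨s, hs⟩ := exists_forall_of_extension (fun k : ι => r.deg k.1) P
    fun ⟨b, f, hf⟩ t ht => by
      have hfg {c : A} (g : b ⟶ c) (hg : nonidentities W₁ g) : nonidentities W₁ (f ≫ g) :=
        r.nonidentities_comp₁ hf hg.1
      have hlt {c : A} (g : b ⟶ c) (hg : nonidentities W₁ g) : r.deg c < r.deg b :=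
        r.lt₁ g hg.1 hg.2
      have congr_t {c : A} {g g' : a ⟶ c} (hg : nonidentities W₁ g) (hg' : nonidentities W₁ g')
          (hc : r.deg c < r.deg b) (e : g = g') : t ⟨c, g, hg⟩ hc = t ⟨c, g', hg'⟩ hc := by
        subst e; rfl
      obtain ⟨x, hx⟩ := exists_matchingObj_lift_at (Y := X)
        (fun c (g : b ⟶ c) hg => t ⟨c, f ≫ g, hfg g hg⟩ (hlt g hg)) fun c d g hg k hk hgk =>
          ((ht ⟨c, _, hfg g hg⟩ (hlt g hg)).2.2 k hk).trans (congr_t _ _ _ (Category.assoc _ _ _))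
      obtain ⟨l, hl₁, hl₂, hl₃⟩ := (hasLiftingProperty_relativeMatchingMap_iff φ i).1
        (h b (r.lt₁ f hf.1 hf.2)) x (y ≫ matchingProjAt Y f hf) (e ≫ matchingProjAt X f hf)
        (by
          refine matchingObj_hom_ext_at fun c g hg => ?_
          rw [Category.assoc, matchingMap_matchingProjAt, reassoc_of% hx, Category.assoc,
            Category.assoc, matchingπ_matchingProjAt, matchingProjAt_map Y f hf g hg.1 (hfg g hg)]
          exact (ht _ (hlt g hg)).2.1)
        (by
          refine matchingObj_hom_ext_at fun c g hg => ?_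
          rw [Category.assoc, hx, Category.assoc, Category.assoc, matchingπ_matchingProjAt,
            matchingProjAt_map X f hf g hg.1 (hfg g hg)]
          exact (ht _ (hlt g hg)).1)
        (by rw [← sq.w_assoc, matchingMap_matchingProjAt, Category.assoc])
      refine ⟨l, hl₃, hl₂, fun c g hg => ?_⟩
      dsimp only
      rw [← hx g hg, ← hl₁, Category.assoc, matchingπ_matchingProjAt]
  obtain ⟨l, hl⟩ := exists_matchingObj_lift_at (Y := X)
    (fun b g hg => s ⟨b, g, hg⟩) fun b b' g hg g' hg' hgg' => (hs ⟨b, g, hg⟩).2.2 g' hg'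
  refine ⟨⟨l, matchingObj_hom_ext_at fun b g hg => ?_, matchingObj_hom_ext_at fun b g hg => ?_⟩⟩
  · rw [Category.assoc, hl]
    exact (hs ⟨b, g, hg⟩).1
  · rw [Category.assoc, matchingMap_matchingProjAt, reassoc_of% hl]
    exact (hs ⟨b, g, hg⟩).2.1

/-- The morphism `L_a φ` has the left lifting property with respect to `p` if the relative
latching morphisms of `φ` at objects of smaller degree do. -/
lemma hasLiftingProperty_latchingMap [HasColimits C] {X Y : A ⥤ C} (φ : X ⟶ Y) {P Q : C}
    (p : P ⟶ Q) (a : A)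
    (h : ∀ b, r.deg b < r.deg a → HasLiftingProperty (relativeLatchingMap W₂ b φ) p) :
    HasLiftingProperty (latchingMap W₂ a φ) p := by
  refine ⟨fun {x z} sq => ?_⟩
  let ι : Type w := Σ b, { f : b ⟶ a // nonidentities W₂ f }
  let R (k : ι) (y : Y.obj k.1 ⟶ P)
      (t : ∀ k' : ι, r.deg k'.1 < r.deg k.1 → (Y.obj k'.1 ⟶ P)) : Prop :=
    φ.app k.1 ≫ y = latchingInclAt X k.2.1 k.2.2 ≫ x ∧ y ≫ p = latchingInclAt Y k.2.1 k.2.2 ≫ z ∧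
      ∀ ⦃b : A⦄ (g : b ⟶ k.1) (hg : nonidentities W₂ g),
        Y.map g ≫ y = t ⟨b, g ≫ k.2.1, r.nonidentities_comp₂ hg.1 k.2.2⟩ (r.lt₂ _ hg.1 hg.2)
  obtain ⟨s, hs⟩ := exists_forall_of_extension (fun k : ι => r.deg k.1) R
    fun ⟨b, f, hf⟩ t ht => by
      have hgf {c : A} (g : c ⟶ b) (hg : nonidentities W₂ g) : nonidentities W₂ (g ≫ f) :=
        r.nonidentities_comp₂ hg.1 hf
      have hlt {c : A} (g : c ⟶ b) (hg : nonidentities W₂ g) : r.deg c < r.deg b :=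
        r.lt₂ g hg.1 hg.2
      have congr_t {c : A} {g g' : c ⟶ a} (hg : nonidentities W₂ g) (hg' : nonidentities W₂ g')
          (hc : r.deg c < r.deg b) (e : g = g') : t ⟨c, g, hg⟩ hc = t ⟨c, g', hg'⟩ hc := by
        subst e; rfl
      obtain ⟨y, hy⟩ := exists_latchingObj_desc_at (Y := Y)
        (fun c (g : c ⟶ b) hg => t ⟨c, g ≫ f, hgf g hg⟩ (hlt g hg)) fun c d g hg k hk hgk =>
          ((ht ⟨c, _, hgf g hg⟩ (hlt g hg)).2.2 k hk).trans (congr_t _ _ _ (Category.assoc _ _ _).symm)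
      obtain ⟨l, hl₁, hl₂, hl₃⟩ := (hasLiftingProperty_relativeLatchingMap_iff φ p).1
        (h b (r.lt₂ f hf.1 hf.2)) (latchingInclAt X f hf ≫ x) y (latchingInclAt Y f hf ≫ z)
        (by
          refine latchingObj_hom_ext_at fun c g hg => ?_
          rw [latchingInclAt_latchingι_assoc, latchingInclAt_latchingMap_assoc, hy,
            map_latchingInclAt_assoc X f hf g hg.1 (hgf g hg)]
          exact (ht ⟨c, _, hgf g hg⟩ (hlt g hg)).1.symm)
        (by rw [Category.assoc, sq.w, latchingInclAt_latchingMap_assoc])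
        (by
          refine latchingObj_hom_ext_at fun c g hg => ?_
          rw [latchingInclAt_latchingι_assoc, reassoc_of% hy,
            map_latchingInclAt_assoc Y f hf g hg.1 (hgf g hg)]
          exact (ht ⟨c, _, hgf g hg⟩ (hlt g hg)).2.1.symm)
      refine ⟨l, hl₁, hl₃, fun c g hg => ?_⟩
      dsimp only
      rw [← hy g hg, ← hl₂, latchingInclAt_latchingι_assoc]
  obtain ⟨l, hl⟩ := exists_latchingObj_desc_at (Y := Y)
    (fun b g hg => s ⟨b, g, hg⟩) fun b b' g hg g' hg' hgg' => (hs ⟨b, g, hg⟩).2.2 g' hg'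
  refine ⟨⟨l, latchingObj_hom_ext_at fun b g hg => ?_, latchingObj_hom_ext_at fun b g hg => ?_⟩⟩
  · rw [latchingInclAt_latchingMap_assoc, hl]
    exact (hs ⟨b, g, hg⟩).1
  · rw [reassoc_of% hl]
    exact (hs ⟨b, g, hg⟩).2.1

end HomotopicalAlgebra.ReedyStructure

/-! ### Adjoints of evaluation, latching and matching; the boundary maps. -/

noncomputable section

variable {A : Type w} [SmallCategory A] {C : Type u} [Category.{w} C]

section

variable [HasColimits C] {a b c : A}

/-- The inclusion of the copy of `E` corresponding to `f : a ⟶ b` in the value at `b` of the functor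
freely generated by `E` at `a`. -/
def evaluationLeftAdjointIncl (E : C) (f : a ⟶ b) : E ⟶ ((evaluationLeftAdjoint C a).obj E).obj b :=
  Sigma.ι (fun _ : a ⟶ b => E) f

lemma evaluationLeftAdjointIncl_map (E : C) (f : a ⟶ b) (g : b ⟶ c) :
    evaluationLeftAdjointIncl E f ≫ ((evaluationLeftAdjoint C a).obj E).map g =
      evaluationLeftAdjointIncl E (f ≫ g) :=
  Sigma.ι_desc _ _

lemma evaluationLeftAdjointIncl_map_app {E F : C} (i : E ⟶ F) (f : a ⟶ b) :
    evaluationLeftAdjointIncl E f ≫ ((evaluationLeftAdjoint C a).map i).app b =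
      i ≫ evaluationLeftAdjointIncl F f :=
  Sigma.ι_desc _ _

lemma evaluationLeftAdjoint_hom_ext {E P : C} {g g' : ((evaluationLeftAdjoint C a).obj E).obj b ⟶ P}
    (h : ∀ f : a ⟶ b, evaluationLeftAdjointIncl E f ≫ g = evaluationLeftAdjointIncl E f ≫ g') :
    g = g' :=
  Sigma.hom_ext _ _ h

lemma exists_evaluationLeftAdjoint_desc {E P : C} (t : (a ⟶ b) → (E ⟶ P)) :
    ∃ g : ((evaluationLeftAdjoint C a).obj E).obj b ⟶ P,
      ∀ f, evaluationLeftAdjointIncl E f ≫ g = t f :=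
  ⟨Sigma.desc t, fun f => Sigma.ι_desc t f⟩

lemma evaluationAdjunctionRight_homEquiv_apply {E : C} {X : A ⥤ C}
    (g : (evaluationLeftAdjoint C a).obj E ⟶ X) :
    (evaluationAdjunctionRight C a).homEquiv E X g = evaluationLeftAdjointIncl E (𝟙 a) ≫ g.app a := by
  rw [Adjunction.homEquiv_unit, evaluationAdjunctionRight_unit_app]
  rfl

end

lemma evaluationAdjunctionLeft_homEquiv_apply_app [HasLimits C] {b c : A} {X : A ⥤ C} {P : C}
    (g : X.obj b ⟶ P) (k : c ⟶ b) :
    ((evaluationAdjunctionLeft C b).homEquiv X P g).app c ≫ Pi.π (fun _ : c ⟶ b => P) k =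
      X.map k ≫ g := by
  rw [evaluationAdjunctionLeft, Adjunction.mkOfHomEquiv_homEquiv]
  exact Pi.lift_π _ k

lemma evaluationRightAdjoint_hom_ext [HasLimits C] {b c : A} {E P : C}
    {g g' : E ⟶ ((evaluationRightAdjoint C b).obj P).obj c}
    (h : ∀ k : c ⟶ b, g ≫ Pi.π (fun _ : c ⟶ b => P) k = g' ≫ Pi.π (fun _ : c ⟶ b => P) k) :
    g = g' :=
  Pi.hom_ext _ _ h

section

variable (C) [HasColimits C] (W₂ : MorphismProperty A) [W₂.IsMultiplicative] (a : A)

/-- The latching object functor. -/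
abbrev latchingFunctor : (A ⥤ C) ⥤ C where
  obj X := latchingObj W₂ a X
  map φ := latchingMap W₂ a φ
  map_id X := ((Functor.whiskeringLeft _ _ C).obj (latchingForget W₂ a) ⋙ colim).map_id X
  map_comp φ ψ := ((Functor.whiskeringLeft _ _ C).obj (latchingForget W₂ a) ⋙ colim).map_comp φ ψ

/-- The natural transformation from the latching object to the value. -/
def latchingιNatTrans : latchingFunctor C W₂ a ⟶ (evaluation A C).obj a where
  app X := latchingι W₂ a X
  naturality _ _ φ := (latchingι_naturality W₂ a φ).symm

variable [HasLimits C]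

/-- The latching object functor is a left adjoint. -/
def latchingAdjunction :
    latchingFunctor C W₂ a ⊣ Functor.const _ ⋙ (latchingForget W₂ a).ran :=
  ((latchingForget W₂ a).ranAdjunction C).comp colimConstAdj

variable {C} in
/-- The morphism of functors which classifies lifting problems for relative latching morphisms. -/
abbrev coboundaryMap {P Q : C} (p : P ⟶ Q) :=
  leibnizPullback (conjugateEquiv (evaluationAdjunctionLeft C a) (latchingAdjunction C W₂ a)
    (latchingιNatTrans C W₂ a)) p

/-- This makes a condition on relative latching maps into a left lifting property of `φ` itself, so
that it can be tested on generators. -/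
lemma hasLiftingProperty_coboundaryMap_iff {X Y : A ⥤ C} (φ : X ⟶ Y) {P Q : C} (p : P ⟶ Q) :
    HasLiftingProperty φ (coboundaryMap W₂ a p) ↔
      HasLiftingProperty (relativeLatchingMap W₂ a φ) p :=
  (hasLiftingProperty_leibnizPushout_iff (latchingAdjunction C W₂ a)
    (evaluationAdjunctionLeft C a) (latchingιNatTrans C W₂ a) _
    (Equiv.symm_apply_apply _ _) φ p).symm

end

section

variable (C) [HasLimits C] (W₁ : MorphismProperty A) [W₁.IsMultiplicative] (a : A)

/-- The matching object functor. -/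
abbrev matchingFunctor : (A ⥤ C) ⥤ C where
  obj X := matchingObj W₁ a X
  map φ := matchingMap W₁ a φ
  map_id X := ((Functor.whiskeringLeft _ _ C).obj (matchingForget W₁ a) ⋙ lim).map_id X
  map_comp φ ψ := ((Functor.whiskeringLeft _ _ C).obj (matchingForget W₁ a) ⋙ lim).map_comp φ ψ

/-- The natural transformation from the value to the matching object. -/
def matchingπNatTrans : (evaluation A C).obj a ⟶ matchingFunctor C W₁ a where
  app X := matchingπ W₁ a X
  naturality _ _ φ := (matchingπ_naturality W₁ a φ).symm

variable [HasColimits C]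

/-- The left adjoint of the matching object functor at `a`: the tensor product with the boundary
of the representable functor at `a`. -/
def boundaryFunctor : C ⥤ A ⥤ C :=
  Functor.const _ ⋙ (matchingForget W₁ a).lan

/-- The boundary functor is left adjoint to the matching object functor. -/
def boundaryAdjunction : boundaryFunctor C W₁ a ⊣ matchingFunctor C W₁ a :=
  constLimAdj.comp ((matchingForget W₁ a).lanAdjunction C)

/-- The inclusion of the boundary. -/
def boundaryι : boundaryFunctor C W₁ a ⟶ evaluationLeftAdjoint C a :=
  (conjugateEquiv (evaluationAdjunctionRight C a) (boundaryAdjunction C W₁ a)).symm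
    (matchingπNatTrans C W₁ a)

variable {C}

/-- The domain of the morphism `boundaryMap W₁ a i`. -/
abbrev boundaryObj {E F : C} (i : E ⟶ F) : A ⥤ C :=
  pushout ((boundaryι C W₁ a).app E) ((boundaryFunctor C W₁ a).map i)

/-- The pushout-product of a morphism with the inclusion of the boundary of the representable
functor at `a`. -/
def boundaryMap {E F : C} (i : E ⟶ F) : boundaryObj W₁ a i ⟶ (evaluationLeftAdjoint C a).obj F :=
  leibnizPushout (boundaryι C W₁ a) i

/-- The inclusion of the boundary is by definition conjugate to `X a ⟶ M_a X`, so the Leibniz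
duality applies directly. -/
lemma hasLiftingProperty_boundaryMap_iff {E F : C} (i : E ⟶ F) {X Y : A ⥤ C} (φ : X ⟶ Y) :
    HasLiftingProperty (boundaryMap W₁ a i) φ ↔
      HasLiftingProperty i (relativeMatchingMap W₁ a φ) :=
  hasLiftingProperty_leibnizPushout_iff (boundaryAdjunction C W₁ a)
    (evaluationAdjunctionRight C a) _ (matchingπNatTrans C W₁ a) rfl i φ

section

variable {W₁ a} {b c : A}

/-- The inclusion of a copy of `E` in the value at `b` of the boundary functor, corresponding to a
nonidentity inverse morphism `a ⟶ b`. -/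
def boundaryIncl (E : C) (f : a ⟶ b) (hf : nonidentities W₁ f) :
    E ⟶ ((boundaryFunctor C W₁ a).obj E).obj b :=
  (boundaryAdjunction C W₁ a).homEquiv _ _ (𝟙 _) ≫ matchingProjAt _ f hf

lemma boundaryIncl_app (E : C) {X : A ⥤ C} (g : (boundaryFunctor C W₁ a).obj E ⟶ X)
    (f : a ⟶ b) (hf : nonidentities W₁ f) :
    boundaryIncl E f hf ≫ g.app b =
      (boundaryAdjunction C W₁ a).homEquiv _ _ g ≫ matchingProjAt _ f hf := by
  have h := (boundaryAdjunction C W₁ a).homEquiv_naturality_right (𝟙 _) g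
  rw [Category.id_comp] at h
  rw [h, boundaryIncl, Category.assoc, Category.assoc]
  congr 1
  exact (matchingMap_matchingProjAt g f hf).symm

lemma boundaryIncl_map (E : C) (f : a ⟶ b) (hf : nonidentities W₁ f) (g : b ⟶ c) (hg : W₁ g)
    (hfg : nonidentities W₁ (f ≫ g)) :
    boundaryIncl E f hf ≫ ((boundaryFunctor C W₁ a).obj E).map g = boundaryIncl E (f ≫ g) hfg := by
  rw [boundaryIncl, boundaryIncl, Category.assoc]
  congr 1
  exact matchingProjAt_map _ f hf g hg hfg

lemma boundaryIncl_naturality {E F : C} (i : E ⟶ F) (f : a ⟶ b) (hf : nonidentities W₁ f) :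
    i ≫ boundaryIncl F f hf = boundaryIncl E f hf ≫ ((boundaryFunctor C W₁ a).map i).app b := by
  have h := (boundaryAdjunction C W₁ a).homEquiv_naturality_left i (𝟙 _)
  rw [Category.comp_id] at h
  rw [boundaryIncl_app, boundaryIncl, h, Category.assoc]

lemma boundaryIncl_boundaryι (E : C) (f : a ⟶ b) (hf : nonidentities W₁ f) :
    boundaryIncl E f hf ≫ ((boundaryι C W₁ a).app E).app b =
      evaluationLeftAdjointIncl E f := by
  have h := homEquiv_conjugateEquiv_symm (boundaryAdjunction C W₁ a)
    (evaluationAdjunctionRight C a) (matchingπNatTrans C W₁ a) (𝟙 ((evaluationLeftAdjoint C a).obj E))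
  rw [Category.comp_id] at h
  rw [boundaryIncl_app]
  refine (congr_arg (· ≫ matchingProjAt _ f hf) h).trans ?_
  rw [evaluationAdjunctionRight_homEquiv_apply]
  dsimp only [matchingπNatTrans]
  rw [Category.assoc, Category.assoc, matchingπ_matchingProjAt, NatTrans.id_app, Category.id_comp]
  rw [evaluationLeftAdjointIncl_map, Category.id_comp]

/-- Transposing first along evaluation and its right adjoint, then along the boundary adjunction,
gives a map into a matching object, which its projections detect. No formula for the Kan extension
is needed. -/
lemma boundaryFunctor_hom_ext {E P : C} {g g' : ((boundaryFunctor C W₁ a).obj E).obj b ⟶ P}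
    (h : ∀ ⦃c : A⦄ (f : a ⟶ c) (hf : nonidentities W₁ f) (k : c ⟶ b),
      boundaryIncl E f hf ≫ ((boundaryFunctor C W₁ a).obj E).map k ≫ g =
        boundaryIncl E f hf ≫ ((boundaryFunctor C W₁ a).obj E).map k ≫ g') : g = g' := by
  apply ((evaluationAdjunctionLeft C b).homEquiv _ _).injective
  apply ((boundaryAdjunction C W₁ a).homEquiv _ _).injective
  refine matchingObj_hom_ext_at fun c f hf => ?_
  rw [← boundaryIncl_app, ← boundaryIncl_app]
  refine evaluationRightAdjoint_hom_ext fun k => ?_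
  have e (g : ((boundaryFunctor C W₁ a).obj E).obj b ⟶ P) := congr_arg (boundaryIncl E f hf ≫ ·)
    (evaluationAdjunctionLeft_homEquiv_apply_app g k)
  exact (Category.assoc _ _ _).trans (((e g).trans ((h f hf k).trans (e g').symm)).trans
    (Category.assoc _ _ _).symm)

end

end

end

section

variable {A : Type w} [SmallCategory A] {C : Type u} [Category.{w} C] [HasLimits C] [HasColimits C]
  {W₁ : MorphismProperty A} [W₁.IsMultiplicative] {a b : A}

/-- Evaluation at `b` preserves the pushout. -/
lemma boundaryObj_hom_ext {E F P : C} {i : E ⟶ F} {g g' : (boundaryObj W₁ a i).obj b ⟶ P}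
    (h₁ : (pushout.inl ((boundaryι C W₁ a).app E) ((boundaryFunctor C W₁ a).map i)).app b ≫ g =
      (pushout.inl ((boundaryι C W₁ a).app E) ((boundaryFunctor C W₁ a).map i)).app b ≫ g')
    (h₂ : (pushout.inr ((boundaryι C W₁ a).app E) ((boundaryFunctor C W₁ a).map i)).app b ≫ g =
      (pushout.inr ((boundaryι C W₁ a).app E) ((boundaryFunctor C W₁ a).map i)).app b ≫ g') :
    g = g' :=
  ((IsPushout.of_hasPushout ((boundaryι C W₁ a).app E) ((boundaryFunctor C W₁ a).map i)).map
    ((evaluation A C).obj b)).hom_ext h₁ h₂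

end

/-! ### Relative latching maps of the boundary maps. -/

namespace HomotopicalAlgebra.ReedyStructure

variable {A : Type w} [SmallCategory A] {W₁ W₂ : MorphismProperty A} [W₁.IsMultiplicative]
  [W₂.IsMultiplicative] {lam : Type v} [LinearOrder lam] [OrderBot lam] [SuccOrder lam]
  [WellFoundedLT lam] (r : ReedyStructure W₁ W₂ lam) {C : Type u} [Category.{w} C]
  [HasLimits C] [HasColimits C]

include r in
/-- The relative latching morphisms of `boundaryMap W₁ a i` have the left lifting property with
respect to `p` if `i` does. -/
lemma hasLiftingProperty_relativeLatchingMap_boundaryMap (a b : A) {E F P Q : C} (i : E ⟶ F)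
    (p : P ⟶ Q) [HasLiftingProperty i p] :
    HasLiftingProperty (relativeLatchingMap W₂ b (boundaryMap W₁ a i)) p := by
  rw [hasLiftingProperty_relativeLatchingMap_iff]
  intro x y z h₁ h₂ h₃
  let D := boundaryObj W₁ a i
  let G := (evaluationLeftAdjoint C a).obj F
  let inl : (evaluationLeftAdjoint C a).obj E ⟶ D :=
    pushout.inl ((boundaryι C W₁ a).app E) ((boundaryFunctor C W₁ a).map i)
  let inr : (boundaryFunctor C W₁ a).obj F ⟶ D :=
    pushout.inr ((boundaryι C W₁ a).app E) ((boundaryFunctor C W₁ a).map i)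
  have inl_map : inl ≫ boundaryMap W₁ a i = (evaluationLeftAdjoint C a).map i :=
    pushout.inl_desc _ _ _
  have inr_map : inr ≫ boundaryMap W₁ a i = (boundaryι C W₁ a).app F := pushout.inr_desc _ _ _
  have inl_inr : (boundaryι C W₁ a).app E ≫ inl = (boundaryFunctor C W₁ a).map i ≫ inr :=
    pushout.condition
  have inl_map_app (c : A) : inl.app c ≫ (boundaryMap W₁ a i).app c =
      ((evaluationLeftAdjoint C a).map i).app c := by rw [← inl_map, NatTrans.comp_app]
  have inr_map_app (c : A) : inr.app c ≫ (boundaryMap W₁ a i).app c =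
      ((boundaryι C W₁ a).app F).app c := by rw [← inr_map, NatTrans.comp_app]
  have inl_inr_app (c : A) : ((boundaryι C W₁ a).app E).app c ≫ inl.app c =
      ((boundaryFunctor C W₁ a).map i).app c ≫ inr.app c := by
    rw [← NatTrans.comp_app, inl_inr, NatTrans.comp_app]
  have hy ⦃c : A⦄ (u : c ⟶ b) (hu : nonidentities W₂ u) :
      D.map u ≫ x = (boundaryMap W₁ a i).app c ≫ latchingInclAt G u hu ≫ y := by
    rw [← latchingInclAt_latchingι_assoc D u hu, h₁, latchingInclAt_latchingMap_assoc]
  have hyp ⦃c : A⦄ (u : c ⟶ b) (hu : nonidentities W₂ u) :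
      latchingInclAt G u hu ≫ y ≫ p = G.map u ≫ z := by
    rw [← h₃, latchingInclAt_latchingι_assoc]
  -- A lift is a family of maps `F ⟶ P` indexed by `f : a ⟶ b`. The component at `f` must restrict
  -- to `X f` along `i`. It must also equal every `Y` coming from a factorization of `f` that starts
  -- with a nonidentity inverse morphism, and every `Z` coming from one that ends with a nonidentity
  -- direct morphism.
  let X (f : a ⟶ b) : E ⟶ P := evaluationLeftAdjointIncl E f ≫ inl.app b ≫ x
  let Y ⦃c : A⦄ (f : a ⟶ c) (hf : nonidentities W₁ f) (g : c ⟶ b) : F ⟶ P :=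
    boundaryIncl F f hf ≫ ((boundaryFunctor C W₁ a).obj F).map g ≫ inr.app b ≫ x
  let Z ⦃c : A⦄ (g : a ⟶ c) (u : c ⟶ b) (hu : nonidentities W₂ u) : F ⟶ P :=
    evaluationLeftAdjointIncl F g ≫ latchingInclAt G u hu ≫ y
  have hXp (f : a ⟶ b) : X f ≫ p = i ≫ evaluationLeftAdjointIncl F f ≫ z := by
    simp only [X, Category.assoc, ← h₂]
    rw [reassoc_of% inl_map_app b, ← Category.assoc, evaluationLeftAdjointIncl_map_app,
      Category.assoc]
  have hiY ⦃c : A⦄ (f : a ⟶ c) (hf : nonidentities W₁ f) (g : c ⟶ b) :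
      i ≫ Y f hf g = X (f ≫ g) := by
    simp only [X, Y]
    rw [← Category.assoc, boundaryIncl_naturality, Category.assoc, ← NatTrans.naturality_assoc,
      ← reassoc_of% inl_inr_app b, NatTrans.naturality_assoc, ← Category.assoc,
      boundaryIncl_boundaryι, ← Category.assoc, evaluationLeftAdjointIncl_map]
  have hYp ⦃c : A⦄ (f : a ⟶ c) (hf : nonidentities W₁ f) (g : c ⟶ b) :
      Y f hf g ≫ p = evaluationLeftAdjointIncl F (f ≫ g) ≫ z := by
    simp only [Y, Category.assoc, ← h₂]
    rw [reassoc_of% inr_map_app b, NatTrans.naturality_assoc, ← Category.assoc,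
      boundaryIncl_boundaryι, ← Category.assoc, evaluationLeftAdjointIncl_map]
  have hiZ ⦃c : A⦄ (g : a ⟶ c) (u : c ⟶ b) (hu : nonidentities W₂ u) :
      i ≫ Z g u hu = X (g ≫ u) := by
    simp only [X, Z]
    rw [← Category.assoc, ← evaluationLeftAdjointIncl_map_app, Category.assoc, ← inl_map_app,
      Category.assoc, ← hy u hu, ← NatTrans.naturality_assoc, ← Category.assoc,
      evaluationLeftAdjointIncl_map]
  have hZp ⦃c : A⦄ (g : a ⟶ c) (u : c ⟶ b) (hu : nonidentities W₂ u) :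
      Z g u hu ≫ p = evaluationLeftAdjointIncl F (g ≫ u) ≫ z := by
    simp only [Z, Category.assoc]
    rw [hyp u hu, ← Category.assoc, evaluationLeftAdjointIncl_map]
  have hYZ ⦃c d : A⦄ (f : a ⟶ c) (hf : nonidentities W₁ f) (g : c ⟶ d) (u : d ⟶ b)
      (hu : nonidentities W₂ u) : Y f hf (g ≫ u) = Z (f ≫ g) u hu := by
    simp only [Y, Z]
    rw [Functor.map_comp_assoc, NatTrans.naturality_assoc, hy u hu, reassoc_of% inr_map_app d,
      NatTrans.naturality_assoc, ← Category.assoc,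
      boundaryIncl_boundaryι, ← Category.assoc, evaluationLeftAdjointIncl_map]
  have hY ⦃c d : A⦄ (f : a ⟶ c) (hf : nonidentities W₁ f) (k : c ⟶ d) (hk : W₁ k) (g : d ⟶ b)
      (hfk : nonidentities W₁ (f ≫ k)) : Y f hf (k ≫ g) = Y (f ≫ k) hfk g := by
    simp only [Y]
    rw [Functor.map_comp_assoc, ← boundaryIncl_map F f hf k hk hfk, Category.assoc]
  have hZ ⦃c d : A⦄ (g : a ⟶ c) (k : c ⟶ d) (hk : W₂ k) (u : d ⟶ b) (hu : nonidentities W₂ u)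
      (hku : nonidentities W₂ (k ≫ u)) : Z (g ≫ k) u hu = Z g (k ≫ u) hku := by
    simp only [Z]
    rw [← evaluationLeftAdjointIncl_map, Category.assoc,
      map_latchingInclAt_assoc G u hu k hk hku]
  -- Uniqueness of the Reedy factorization, phrased for an arbitrary predicate `R` to avoid
  -- transport along an equality of middle objects.
  have ext_fac ⦃f : a ⟶ b⦄ ⦃c d : A⦄ (f₁ : a ⟶ c) (f₂ : c ⟶ b) (g₁ : a ⟶ d) (g₂ : d ⟶ b)
      (hf : f₁ ≫ f₂ = f) (hg : g₁ ≫ g₂ = f) (hf₁ : W₁ f₁) (hf₂ : W₂ f₂) (hg₁ : W₁ g₁)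
      (hg₂ : W₂ g₂) (R : ∀ ⦃e : A⦄, (a ⟶ e) → (e ⟶ b) → Prop) (h : R f₁ f₂) : R g₁ g₂ := by
    have := r.subsingleton_mapFactorizationData f
    have e : MorphismProperty.MapFactorizationData.mk c f₁ f₂ hf hf₁ hf₂ =
      .mk d g₁ g₂ hg hg₁ hg₂ := Subsingleton.elim _ _
    cases e
    exact h
  have main (f : a ⟶ b) : ∃ l : F ⟶ P, i ≫ l = X f ∧ l ≫ p = evaluationLeftAdjointIncl F f ≫ z ∧
      (∀ ⦃c : A⦄ (w : a ⟶ c) (hw : nonidentities W₁ w) (g : c ⟶ b), w ≫ g = f → l = Y w hw g) ∧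
      (∀ ⦃c : A⦄ (g : a ⟶ c) (u : c ⟶ b) (hu : nonidentities W₂ u), g ≫ u = f → l = Z g u hu) := by
    have deg_w ⦃c : A⦄ (w : a ⟶ c) (hw : nonidentities W₁ w) (g : c ⟶ b) (e : w ≫ g = f) :
        r.degHom f < r.deg a := by
      rw [← e]; exact (r.degHom_le w g).trans_lt (r.lt₁ w hw.1 hw.2)
    have deg_u ⦃c : A⦄ (g : a ⟶ c) (u : c ⟶ b) (hu : nonidentities W₂ u) (e : g ≫ u = f) :
        r.degHom f < r.deg b := by
      rw [← e]; exact (r.degHom_le g u).trans_lt (r.lt₂ u hu.1 hu.2)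
    -- If the degree drops, the inverse part of `f` is not an identity and `Y` prescribes the
    -- component. Otherwise `f` is direct: if it is not an identity, `Z` prescribes the component,
    -- and if it is, nothing does.
    by_cases ha : r.degHom f < r.deg a
    · obtain ⟨c, f₁, f₂, hf₁, hf₂, hf, hdeg⟩ := r.exists_fac f
      have hn : nonidentities W₁ f₁ := ⟨hf₁, by rintro ⟨⟩; exact (hdeg ▸ ha).false⟩
      refine ⟨Y f₁ hn f₂, by rw [hiY, hf], by rw [hYp, hf], fun d w hw g e => ?_,
        fun d g u hu e => ?_⟩
      -- Absorbing the inverse part of `g` into `w` yields a Reedy factorization of `f`, which must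
      -- be the chosen one.
      · obtain ⟨c', g₁, g₂, hg₁, hg₂, rfl, -⟩ := r.exists_fac g
        rw [hY w hw g₁ hg₁ g₂ (r.nonidentities_comp₁ hw hg₁)]
        exact ext_fac (w ≫ g₁) g₂ f₁ f₂ (by rw [Category.assoc, e]) hf (W₁.comp_mem _ _ hw.1 hg₁)
          hg₂ hf₁ hf₂ (fun e k₁ k₂ => ∀ hn, Y k₁ hn k₂ = Y (w ≫ g₁) _ g₂) (fun _ => rfl) hn
      · obtain ⟨c', g₁, g₂, hg₁, hg₂, rfl, -⟩ := r.exists_fac g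
        refine ext_fac g₁ (g₂ ≫ u) f₁ f₂ (by rw [← Category.assoc, e]) hf hg₁
          (W₂.comp_mem _ _ hg₂ hu.1) hf₁ hf₂ (fun e k₁ k₂ => ∀ hn, Y k₁ hn k₂ = Z (g₁ ≫ g₂) u hu)
          (fun hn => hYZ _ _ _ _ _) hn
    · have ha' : r.degHom f = r.deg a := (r.degHom_le_deg_left f).antisymm (not_lt.1 ha)
      have hf : W₂ f := r.prop₂_of_degHom_eq_deg_left ha'
      by_cases hid : MorphismProperty.identities A f
      -- The only free component, and the only use of the lifting property of `i` against `p`.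
      · have sq : CommSq (X f) i p (evaluationLeftAdjointIncl F f ≫ z) := ⟨hXp f⟩
        refine ⟨sq.lift, sq.fac_left, sq.fac_right, fun c w hw g e => ?_, fun c g u hu e => ?_⟩
        · exact (ha (deg_w w hw g e)).elim
        · have := deg_u g u hu e
          rw [ha'] at this
          cases hid
          exact this.false.elim
      · refine ⟨Z (𝟙 a) f ⟨hf, hid⟩, by rw [hiZ, Category.id_comp], by rw [hZp, Category.id_comp],
          fun c w hw g e => (ha (deg_w w hw g e)).elim, fun c g u hu e => ?_⟩
        obtain ⟨c', g₁, g₂, hg₁, hg₂, rfl, -⟩ := r.exists_fac g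
        have hg₂u := r.nonidentities_comp₂ hg₂ hu
        rw [hZ g₁ g₂ hg₂ u hu hg₂u]
        exact ext_fac (𝟙 a) f g₁ (g₂ ≫ u) (Category.id_comp f) (by rw [← Category.assoc, e])
          (W₁.id_mem a) hf hg₁ hg₂u.1
          (fun e k₁ k₂ => ∀ hn, Z (𝟙 a) f ⟨hf, hid⟩ = Z k₁ k₂ hn) (fun _ => rfl) hg₂u
  choose t ht₁ ht₂ ht₃ ht₄ using main
  obtain ⟨l, hl⟩ := exists_evaluationLeftAdjoint_desc t
  refine ⟨l, boundaryObj_hom_ext ?_ ?_, ?_, ?_⟩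
  · change inl.app b ≫ _ = inl.app b ≫ _
    rw [reassoc_of% inl_map_app b]
    refine evaluationLeftAdjoint_hom_ext fun f => ?_
    rw [← Category.assoc, evaluationLeftAdjointIncl_map_app, Category.assoc, hl, ht₁]
  · change inr.app b ≫ _ = inr.app b ≫ _
    rw [reassoc_of% inr_map_app b]
    refine boundaryFunctor_hom_ext fun c f hf k => ?_
    rw [NatTrans.naturality_assoc, ← Category.assoc, boundaryIncl_boundaryι, ← Category.assoc,
      evaluationLeftAdjointIncl_map, hl]
    exact ht₃ _ f hf k rfl
  · refine latchingObj_hom_ext_at fun c u hu => ?_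
    rw [latchingInclAt_latchingι_assoc]
    refine evaluationLeftAdjoint_hom_ext fun g => ?_
    rw [← Category.assoc, evaluationLeftAdjointIncl_map, hl]
    exact ht₄ _ g u hu rfl
  · refine evaluationLeftAdjoint_hom_ext fun f => ?_
    rw [← Category.assoc, hl, ht₂]

end HomotopicalAlgebra.ReedyStructure

/-! ### Weak factorization systems on diagrams. -/

section

variable {A : Type w} [SmallCategory A] {C : Type u} [Category.{w} C] [HasLimits C] [HasColimits C]

/-- The natural transformations whose relative latching morphisms are in `L`. -/
def reedyLeftClass (W₂ : MorphismProperty A) [W₂.IsMultiplicative] (L : MorphismProperty C) :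
    MorphismProperty (A ⥤ C) :=
  fun _ _ φ => ∀ a, L (relativeLatchingMap W₂ a φ)

/-- The natural transformations whose relative matching morphisms are in `R`. -/
def reedyRightClass (W₁ : MorphismProperty A) [W₁.IsMultiplicative] (R : MorphismProperty C) :
    MorphismProperty (A ⥤ C) :=
  fun _ _ φ => ∀ a, R (relativeMatchingMap W₁ a φ)

/-- The morphisms `boundaryMap W₁ a i` for `i` in `I`. -/
def boundaryMaps (W₁ : MorphismProperty A) [W₁.IsMultiplicative] (I : MorphismProperty C) :
    MorphismProperty (A ⥤ C) :=
  ⨆ a, MorphismProperty.ofHoms fun i : I.toSet => boundaryMap W₁ a i.1.hom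

variable {W₁ : MorphismProperty A} [W₁.IsMultiplicative]

instance (I : MorphismProperty C) [MorphismProperty.IsSmall.{w} I] :
    MorphismProperty.IsSmall.{w} (boundaryMaps W₁ I) := by
  unfold boundaryMaps
  infer_instance

lemma boundaryMap_mem_boundaryMaps {I : MorphismProperty C} (a : A) {E F : C} {i : E ⟶ F}
    (hi : I i) : boundaryMaps W₁ I (boundaryMap W₁ a i) :=
  (MorphismProperty.iSup_iff _ _).2
    ⟨a, MorphismProperty.ofHoms.mk (ι := I.toSet) ⟨Arrow.mk i, hi⟩⟩

lemma boundaryMaps_le {I : MorphismProperty C} {P : MorphismProperty (A ⥤ C)}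
    (h : ∀ (a : A) ⦃E F : C⦄ (i : E ⟶ F), I i → P (boundaryMap W₁ a i)) :
    boundaryMaps W₁ I ≤ P :=
  iSup_le fun a => by
    rintro _ _ _ ⟨i⟩
    exact h a _ i.2

lemma rlp_boundaryMaps (I : MorphismProperty C) :
    (boundaryMaps W₁ I).rlp = reedyRightClass W₁ I.rlp := by
  ext X Y φ
  refine ⟨fun h a E F i hi => (hasLiftingProperty_boundaryMap_iff W₁ a i φ).1
    (h _ (boundaryMap_mem_boundaryMaps a hi)), fun h => ?_⟩
  -- Lifting against the single map `φ` is a property of morphisms, so `boundaryMaps_le` reduces it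
  -- to the generators.
  have : boundaryMaps W₁ I ≤ (MorphismProperty.ofHoms fun _ : Unit => φ).llp :=
    boundaryMaps_le fun a E F i hi => (MorphismProperty.llp_ofHoms_iff_hasLiftingProperty Unit _ φ).2
      ((hasLiftingProperty_boundaryMap_iff W₁ a i φ).2 (h a i hi))
  exact fun _ _ g hg => this g hg φ ⟨()⟩

end

namespace HomotopicalAlgebra.ReedyStructure

variable {A : Type w} [SmallCategory A] {W₁ W₂ : MorphismProperty A} [W₁.IsMultiplicative]
  [W₂.IsMultiplicative] {lam : Type v} [LinearOrder lam] [OrderBot lam] [SuccOrder lam]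
  [WellFoundedLT lam] (r : ReedyStructure W₁ W₂ lam) {C : Type u} [Category.{w} C]
  [HasLimits C] [HasColimits C]

include r

/-- Each `coboundaryMap W₂ a p` with `p` in `K` has the right lifting property against the boundary
maps, by the computation of their relative latching maps; hence everything in the left class lifts
against it. -/
lemma llp_rlp_boundaryMaps_le {I K : MorphismProperty C} (h : I ≤ K.llp) :
    (boundaryMaps W₁ I).rlp.llp ≤ reedyLeftClass W₂ K.llp := by
  intro X Y φ hφ a P Q p hp
  rw [← hasLiftingProperty_coboundaryMap_iff]
  refine hφ _ ((MorphismProperty.le_llp_iff_le_rlp _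
    (MorphismProperty.ofHoms fun _ : Unit => coboundaryMap W₂ a p)).1
      (boundaryMaps_le fun b E F i hi => ?_) _ ⟨()⟩)
  rw [MorphismProperty.llp_ofHoms_iff_hasLiftingProperty, hasLiftingProperty_coboundaryMap_iff]
  have := h i hi p hp
  exact r.hasLiftingProperty_relativeLatchingMap_boundaryMap b a i p

/-- A set of morphisms which generates a weak factorization system in a locally presentable
category induces a weak factorization system on diagrams indexed by a Reedy category. -/
lemma isWeakFactorizationSystem [IsLocallyPresentable.{w} C] (I : MorphismProperty C)
    [MorphismProperty.IsSmall.{w} I] :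
    MorphismProperty.IsWeakFactorizationSystem (reedyLeftClass W₂ I.rlp.llp)
      (reedyRightClass W₁ I.rlp) := by
  have := isLocallyPresentable_functor.{w} (A := A) (D := C)
  have := hasSmallObjectArgument_of_isLocallyPresentable.{w} (boundaryMaps W₁ I)
  have hL : (boundaryMaps W₁ I).rlp.llp = reedyLeftClass W₂ I.rlp.llp := by
    refine le_antisymm (r.llp_rlp_boundaryMaps_le I.le_llp_rlp) fun X Y f hf X' Y' p hp => ?_
    rw [rlp_boundaryMaps] at hp
    exact r.hasLiftingProperty_of_relative f p fun a => hf a _ (hp a)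
  rw [← hL, ← rlp_boundaryMaps]
  exact ⟨MorphismProperty.rlp_llp_rlp _, rfl, inferInstance⟩

/-! ### Comparison with pointwise weak equivalences, and cofibrancy of the domains. -/

section

variable [ModelCategory C]

omit [HasColimits C] in
lemma trivialFibrations_matchingMap {X Y : A ⥤ C} (φ : X ⟶ Y) (a : A)
    (h : ∀ b, r.deg b < r.deg a → trivialFibrations C (relativeMatchingMap W₁ b φ)) :
    trivialFibrations C (matchingMap W₁ a φ) := by
  rw [← cofibrations_rlp]
  exact fun _ _ i hi => r.hasLiftingProperty_matchingMap φ i a fun b hb =>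
    MorphismProperty.hasLiftingProperty_of_wfs _ _ hi (h b hb)

omit [HasColimits C] in
lemma trivialFibrations_pullback_snd {X Y : A ⥤ C} (φ : X ⟶ Y) (a : A)
    (h : ∀ b, r.deg b < r.deg a → trivialFibrations C (relativeMatchingMap W₁ b φ)) :
    trivialFibrations C (pullback.snd (matchingMap W₁ a φ) (matchingπ W₁ a Y)) :=
  MorphismProperty.pullback_snd _ _ (r.trivialFibrations_matchingMap φ a h)

omit [HasLimits C] in
lemma trivialCofibrations_pushout_inl {X Y : A ⥤ C} (φ : X ⟶ Y) (a : A)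
    (h : ∀ b, r.deg b < r.deg a → trivialCofibrations C (relativeLatchingMap W₂ b φ)) :
    trivialCofibrations C (pushout.inl (latchingι W₂ a X) (latchingMap W₂ a φ)) := by
  refine MorphismProperty.pushout_inl _ _ ?_
  rw [← fibrations_llp]
  exact fun _ _ p hp => r.hasLiftingProperty_latchingMap φ p a fun b hb =>
    MorphismProperty.hasLiftingProperty_of_wfs _ _ (h b hb) hp

-- The component at `a` is the relative matching map followed by a base change of the map on
-- matching objects, and both are trivial fibrations.
omit [HasColimits C] in
lemma trivialFibrations_app {X Y : A ⥤ C} {φ : X ⟶ Y}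
    (h : reedyRightClass W₁ (trivialFibrations C) φ) (a : A) :
    trivialFibrations C (φ.app a) := by
  have : relativeMatchingMap W₁ a φ ≫ pullback.snd _ _ = φ.app a := pullback.lift_snd _ _ _
  rw [← this]
  exact MorphismProperty.comp_mem _ _ _ (h a) (r.trivialFibrations_pullback_snd φ a fun b _ => h b)

omit [HasColimits C] in
lemma reedyFibrations_inf_weakEquivalences :
    reedyFibrations W₁ ⊓ (weakEquivalences C).functorCategory A =
      reedyRightClass W₁ (trivialFibrations C) := by
  ext X Y φ
  refine ⟨fun ⟨h₁, h₂⟩ => ?_, fun h => ⟨fun a => (h a).1, fun a => (r.trivialFibrations_app h a).2⟩⟩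
  intro a
  -- Triviality at smaller degrees makes the projection from the pullback a weak equivalence;
  -- two-out-of-three then gives triviality at `a`.
  induction hd : r.deg a using WellFoundedLT.induction generalizing a with
  | ind d ih =>
    subst hd
    refine ⟨h₁ a, ?_⟩
    have := r.trivialFibrations_pullback_snd φ a fun b hb => ih _ hb b rfl
    refine (weakEquivalences C).of_postcomp _ _ this.2 ?_
    rw [relativeMatchingMap, pullback.lift_snd]
    exact h₂ a

omit [HasLimits C] in
lemma reedyCofibrations_inf_weakEquivalences :
    reedyCofibrations W₂ ⊓ (weakEquivalences C).functorCategory A =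
      reedyLeftClass W₂ (trivialCofibrations C) := by
  have key {X Y : A ⥤ C} (φ : X ⟶ Y) (a : A) :
      pushout.inl _ _ ≫ relativeLatchingMap W₂ a φ = φ.app a := pushout.inl_desc _ _ _
  ext X Y φ
  refine ⟨fun ⟨h₁, h₂⟩ => ?_, fun h => ⟨fun a => (h a).1, fun a => ?_⟩⟩
  · intro a
    induction hd : r.deg a using WellFoundedLT.induction generalizing a with
    | ind d ih =>
      subst hd
      refine ⟨h₁ a, ?_⟩
      have := r.trivialCofibrations_pushout_inl φ a fun b hb => ih _ hb b rfl
      refine (weakEquivalences C).of_precomp _ _ this.2 ?_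
      rw [key]
      exact h₂ a
  · rw [← key]
    exact (weakEquivalences C).comp_mem _ _
      (r.trivialCofibrations_pushout_inl φ a fun b _ => h b).2 (h a).2

/-- The map from the initial diagram factors through the free diagram on `E`. The first leg lifts
because `E` is cofibrant and `φ` is pointwise a trivial fibration. The second is a cobase change of
the boundary functor applied to `i`, which lifts because the map induced by `φ` on matching objects
is a trivial fibration. -/
lemma hasLiftingProperty_initial_to_boundaryObj (a : A) {E F : C} (i : E ⟶ F) [Cofibration i]
    [IsCofibrant E] {X Y : A ⥤ C} {φ : X ⟶ Y} (h : reedyRightClass W₁ (trivialFibrations C) φ) :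
    HasLiftingProperty (initial.to (boundaryObj W₁ a i)) φ := by
  have h₁ : HasLiftingProperty ((boundaryFunctor C W₁ a).map i) φ :=
    ((boundaryAdjunction C W₁ a).hasLiftingProperty_iff i φ).2
      (MorphismProperty.hasLiftingProperty_of_wfs i _ (mem_cofibrations i)
        (r.trivialFibrations_matchingMap φ a fun b _ => h b))
  have h₂ : HasLiftingProperty ((evaluationLeftAdjoint C a).map (initial.to E)) φ :=
    ((evaluationAdjunctionRight C a).hasLiftingProperty_iff _ φ).2
      (MorphismProperty.hasLiftingProperty_of_wfs _ _ (mem_cofibrations (initial.to E))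
        (r.trivialFibrations_app h a))
  have h₃ : HasLiftingProperty (initial.to ((evaluationLeftAdjoint C a).obj E)) φ := by
    have := (evaluationAdjunctionRight C a).leftAdjoint_preservesColimits
    have h₀ : IsInitial ((evaluationLeftAdjoint C a).obj (⊥_ C)) :=
      IsInitial.isInitialObj _ _ initialIsInitial
    have e : Arrow.mk ((evaluationLeftAdjoint C a).map (initial.to E)) ≅
        Arrow.mk (initial.to ((evaluationLeftAdjoint C a).obj E)) :=
      Arrow.isoMk (h₀.uniqueUpToIso initialIsInitial) (Iso.refl _) (h₀.hom_ext _ _)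
    exact HasLiftingProperty.of_arrow_iso_left e φ
  have h₄ : HasLiftingProperty
      (pushout.inl ((boundaryι C W₁ a).app E) ((boundaryFunctor C W₁ a).map i)) φ :=
    (IsPushout.of_hasPushout _ _).hasLiftingProperty φ
  rw [Subsingleton.elim (initial.to (boundaryObj W₁ a i)) (initial.to _ ≫ pushout.inl _ _)]
  infer_instance

end

end HomotopicalAlgebra.ReedyStructure

namespace CategoryTheory.MorphismProperty

instance {C : Type*} [Category* C] (W : MorphismProperty C) [W.HasTwoOutOfThreeProperty]
    (A : Type*) [Category* A] : (W.functorCategory A).HasTwoOutOfThreeProperty where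
  comp_mem _ _ hf hg a := W.comp_mem _ _ (hf a) (hg a)
  of_postcomp _ _ hg hfg a := W.of_postcomp _ _ (hg a) (hfg a)
  of_precomp _ _ hf hfg a := W.of_precomp _ _ (hf a) (hfg a)

end CategoryTheory.MorphismProperty

section

variable {D : Type u} [Category.{v} D] [ModelCategory D] {I J : MorphismProperty D}

lemma IsGeneratingPair.le_cofibrations (h : IsGeneratingPair.{w} I J) : I ≤ cofibrations D := by
  rw [← trivialFibrations_llp, ← h.rlp_left]
  exact I.le_llp_rlp

lemma IsGeneratingPair.le_trivialCofibrations (h : IsGeneratingPair.{w} I J) :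
    J ≤ trivialCofibrations D := by
  rw [← fibrations_llp, ← h.rlp_right]
  exact J.le_llp_rlp

end

/-! ### The Reedy model structure and its generators. -/

namespace HomotopicalAlgebra.ReedyStructure

variable {A : Type w} [SmallCategory A] {W₁ W₂ : MorphismProperty A} [W₁.IsMultiplicative]
  [W₂.IsMultiplicative] {lam : Type v} [LinearOrder lam] [OrderBot lam] [SuccOrder lam]
  [WellFoundedLT lam] (r : ReedyStructure W₁ W₂ lam) {C : Type u} [Category.{w} C]
  [ModelCategory C] [HasLimits C] [HasColimits C] {I J : MorphismProperty C}

include r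

/-- The Reedy model structure. -/
lemma exists_isReedyModelStructure [IsLocallyPresentable.{w} C] (h : IsGeneratingPair.{w} I J) :
    ∃ m : ModelCategory (A ⥤ C), IsReedyModelStructure W₁ W₂ m := by
  have := h.small_left
  have := h.small_right
  let : CategoryWithFibrations (A ⥤ C) := ⟨reedyFibrations W₁⟩
  let : CategoryWithCofibrations (A ⥤ C) := ⟨reedyCofibrations W₂⟩
  let : CategoryWithWeakEquivalences (A ⥤ C) := ⟨(weakEquivalences C).functorCategory A⟩
  have : (weakEquivalences (A ⥤ C)).HasTwoOutOfThreeProperty :=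
    inferInstanceAs ((weakEquivalences C).functorCategory A).HasTwoOutOfThreeProperty
  -- The system generated from `I` pairs cofibrations with trivial fibrations; the one from `J`
  -- below pairs trivial cofibrations with fibrations. The comparison lemmas rewrite the trivial
  -- classes in terms of pointwise weak equivalences.
  have hI := r.isWeakFactorizationSystem I
  rw [h.rlp_left, trivialFibrations_llp, ← r.reedyFibrations_inf_weakEquivalences] at hI
  have : MorphismProperty.IsWeakFactorizationSystem (cofibrations (A ⥤ C))
    (trivialFibrations (A ⥤ C)) := hI
  have hJ := r.isWeakFactorizationSystem J
  rw [h.rlp_right, fibrations_llp, ← r.reedyCofibrations_inf_weakEquivalences] at hJ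
  have : MorphismProperty.IsWeakFactorizationSystem (trivialCofibrations (A ⥤ C))
    (fibrations (A ⥤ C)) := hJ
  exact ⟨.mk' _, rfl, rfl, rfl⟩

variable {m : ModelCategory (A ⥤ C)} (hm : IsReedyModelStructure W₁ W₂ m)

include hm

lemma trivialFibrations_eq : trivialFibrations (A ⥤ C) =
    reedyRightClass W₁ (trivialFibrations C) := by
  rw [trivialFibrations, hm.fibrations_eq, hm.weakEquivalences_eq,
    r.reedyFibrations_inf_weakEquivalences]

lemma isGeneratingPair_boundaryMaps (h : IsGeneratingPair.{w} I J) :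
    IsGeneratingPair.{w} (boundaryMaps W₁ I) (boundaryMaps W₁ J) := by
  have := h.small_left
  have := h.small_right
  refine ⟨inferInstance, inferInstance, ?_, ?_⟩
  · rw [rlp_boundaryMaps, h.rlp_left, r.trivialFibrations_eq hm]
  · rw [rlp_boundaryMaps, h.rlp_right, hm.fibrations_eq]
    rfl

lemma hasCofibrantDomains_boundaryMaps (hI : HasCofibrantDomains I) (hI' : I ≤ cofibrations C) :
    HasCofibrantDomains (boundaryMaps W₁ I) := by
  refine boundaryMaps_le (P := fun X _ _ => IsCofibrant X) fun a E F i hi => ?_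
  have : Cofibration i := ⟨hI' i hi⟩
  have : IsCofibrant E := hI i hi
  rw [isCofibrant_iff, cofibration_iff, ← trivialFibrations_llp, r.trivialFibrations_eq hm]
  exact fun _ _ _ h => r.hasLiftingProperty_initial_to_boundaryObj a i h

end HomotopicalAlgebra.ReedyStructure

theorem mainTheorem9 {A : Type w} [SmallCategory A]
    {W₁ W₂ : MorphismProperty A} [W₁.IsMultiplicative] [W₂.IsMultiplicative]
    {lam : Type v} [LinearOrder lam] [OrderBot lam] [SuccOrder lam] [WellFoundedLT lam]
    (r : ReedyStructure W₁ W₂ lam)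
    {C : Type u} [Category.{w} C] [ModelCategory C] [HasLimits C] [HasColimits C]
    (hC : IsTractable.{w} C) :
    ∃ m : ModelCategory (A ⥤ C), IsReedyModelStructure W₁ W₂ m ∧
      IsTractable.{w} (A ⥤ C) ∧ (IsFullyTractable.{w} C → IsFullyTractable.{w} (A ⥤ C)) := by
  obtain ⟨_, I, J, h, hI⟩ := hC
  obtain ⟨m, hm⟩ := r.exists_isReedyModelStructure h
  have hA := isLocallyPresentable_functor.{w} (A := A) (D := C)
  refine ⟨m, hm, ⟨hA, _, _, r.isGeneratingPair_boundaryMaps hm h,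
    r.hasCofibrantDomains_boundaryMaps hm hI h.le_cofibrations⟩, ?_⟩
  -- This pair may differ from the one used to construct `m`, but the boundary maps of any
  -- generating pair generate the same Reedy classes. Cofibrancy of domains uses only that the maps
  -- are cofibrations, so one lemma serves both `I` and `J`.
  rintro ⟨-, I, J, h, hI, hJ⟩
  exact ⟨hA, _, _, r.isGeneratingPair_boundaryMaps hm h,
    r.hasCofibrantDomains_boundaryMaps hm hI h.le_cofibrations,
    r.hasCofibrantDomains_boundaryMaps hm hJ fun _ _ _ hi => (h.le_trivialCofibrations _ hi).1⟩
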